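/- **Setting.** For each sample size $n$, let $d=d_n$ be a dimension and consider the model $$Y_i=\mu_i^\star+X_i^T\beta^\star+\epsilon_i,\qquad 1\le i\le n,$$ where $\beta^\star\in\mathbb R^{d}$ and $\mu^\star\in\mathbb R^n$ are deterministic (all quantities may depend on $n$). The covariates $X_i$ are i.i.d. copies of $X_0\in\mathbb R^d$, which has mean zero, coordinates with finite fourth moments and covariance matrix $\Sigma_X$. The errors $\epsilon_i$ are i.i.d. with a distribution not depending on $n$, with mean zero and finite variance $\sigma^2$, and they are independent of the covariates. There are positive sequences $\kappa_n,\gamma_n=o(\sqrt n)$ such that $$P\big(\max_{i\le n}\|X_i\|_2>\kappa_n\big)\to0,\qquad P\big(\max_{i\le n}|\epsilon_i|>\gamma_n\big)\to0 .$$ There are integers $s_1,s_2=o(n)$ such that $|\mu_i^\star|\le\gamma_n$ for $s_1<i\le s_1+s_2$ and $\mu_i^\star=0$ for $i>s_1+s_2$. The regularization parameter $\lambda=\lambda_n>0$ satisfies, for some constant $\alpha>2$, $$\sqrt d\,\kappa_n=o(\lambda),\qquad \alpha\gamma_n\le\lambda,\qquad \lambda=o\big(\min_{i\le s_1}|\mu_i^\star|\big)$$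 (the last condition is void if $s_1=0$). **Estimator.** Let $\hat\beta_n$ be a random vector such that, with probability tending to one, there is $\hat\mu\in\mathbb R^n$ for which $(\hat\mu,\hat\beta_n)$ is a global minimizer over $(\mu,\beta)\in\mathbb R^n\times\mathbb R^d$ of $$L(\mu,\beta)=\sum_{i=1}^n(Y_i-\mu_i-X_i^T\beta)^2+2\lambda\sum_{i=1}^n|\mu_i| .$$ **Assumptions.** Let $\|\cdot\|_F$ be the Frobenius norm, let $q$ be a fixed integer, let $A_n$ be deterministic $q\times d$ matrices and let $G_X$ be a symmetric $q\times q$ matrix. Assume: * (B1') $\lambda_{\min}(\Sigma_X)$ is bounded away from zero; * (B2) $d^{-1/2}\|\Sigma_X\|_F$ is bounded; * (C) $d^{-1}\sum_{j=1}^d(\mathbb E X_{0j}^4)^{1/2}$ is bounded; * (D) $\|A_n\|_F$ and $\lambda_{\max}(A_nA_n^T)$ are bounded, and $\|A_n\Sigma_X^{-1}A_n^T-G_X\|_F\to0$; * (E) $\max_{j\le d}\operatorname{Var}(X_{0j})^{1/2}$ and $\min_{j\le d}\mathbb E|X_{0j}|^3$ are bounded from above, and $\min_{j\le d}\operatorname{Var}(X_{0j})^{1/2}$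 is bounded away from zero. **Theorem.** If $d\to\infty$, $d^5\log d=o(n)$, $s_1=o\big(\sqrt n/(\lambda\sqrt d\,\kappa_n)\big)$ and $s_2=o\big(\sqrt n/(\sqrt d\,\kappa_n\gamma_n)\big)$, then $$\sqrt n\,A_n(\hat\beta_n-\beta^\star)\ \xrightarrow{\ d\ }\ N(0,\sigma^2G_X).$$ -/

import Mathlib

open MeasureTheory ProbabilityTheory Filter Topology Asymptotics Matrix

noncomputable section

/-- Penalized least-squares loss with the soft penalty `p_λ(t) = 2 λ t`:
`L(μ, β) = ∑ᵢ (Yᵢ - μᵢ - Xᵢᵀ β)² + ∑ᵢ 2 λ |μᵢ|`. -/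
def plsLoss {n d : ℕ} (X : Fin n → EuclideanSpace ℝ (Fin d)) (Y : Fin n → ℝ) (lam : ℝ)
    (μ : Fin n → ℝ) (β : EuclideanSpace ℝ (Fin d)) : ℝ :=
  ∑ i, (Y i - μ i - inner ℝ (X i) β) ^ 2 + ∑ i, 2 * lam * |μ i|

/-- `β` is a penalized least-squares estimate: it is the `β`-part of a global minimizer
`(μ, β)` of the penalized loss. -/
def IsPLSEstimate {n d : ℕ} (X : Fin n → EuclideanSpace ℝ (Fin d)) (Y : Fin n → ℝ) (lam : ℝ)
    (β : EuclideanSpace ℝ (Fin d)) : Prop :=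
  ∃ μ : Fin n → ℝ, ∀ (μ' : Fin n → ℝ) (β' : EuclideanSpace ℝ (Fin d)),
    plsLoss X Y lam μ β ≤ plsLoss X Y lam μ' β'

/-- The covariance matrix of a distribution `ν` on `ℝᵈ`. -/
def covarianceMat {d : ℕ} (ν : Measure (EuclideanSpace ℝ (Fin d))) : Matrix (Fin d) (Fin d) ℝ :=
  Matrix.of fun j k => cov[fun x => x j, fun x => x k; ν]

/-- The Frobenius norm. -/
def frobNorm {m k : ℕ} (M : Matrix (Fin m) (Fin k) ℝ) : ℝ :=
  √(∑ i, ∑ j, M i j ^ 2)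

/-- The scaled Frobenius norm `d^{-1/2} ‖M‖_F` of a `d × d` matrix. -/
def frobNormScaled {d : ℕ} (M : Matrix (Fin d) (Fin d) ℝ) : ℝ :=
  (√(d : ℝ))⁻¹ * frobNorm M

/-- The smallest eigenvalue of a symmetric matrix (of positive size). -/
def minEigenvalue {d : ℕ} (M : Matrix (Fin d) (Fin d) ℝ) : ℝ := sInf (spectrum ℝ M)

/-- The largest eigenvalue of a symmetric matrix (of positive size). -/
def maxEigenvalue {d : ℕ} (M : Matrix (Fin d) (Fin d) ℝ) : ℝ := sSup (spectrum ℝ M)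

/-- `κ_X = d⁻¹ ∑ⱼ (E X_{0j}⁴)^{1/2}`, for `X₀` with distribution `ν`. -/
def kappaX {d : ℕ} (ν : Measure (EuclideanSpace ℝ (Fin d))) : ℝ :=
  (d : ℝ)⁻¹ * ∑ j : Fin d, √(∫ x, (x j) ^ 4 ∂ν)

/-- `σ_{X,max}`, the largest standard deviation of a coordinate of `X₀ ∼ ν`. -/
def sigmaXMax {d : ℕ} (ν : Measure (EuclideanSpace ℝ (Fin d))) : ℝ :=
  √(⨆ j : Fin d, Var[fun x => x j; ν])

/-- `σ_{X,min}`, the smallest standard deviation of a coordinate of `X₀ ∼ ν`. -/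
def sigmaXMin {d : ℕ} (ν : Measure (EuclideanSpace ℝ (Fin d))) : ℝ :=
  √(⨅ j : Fin d, Var[fun x => x j; ν])

/-- `γ_{X,min} = minⱼ E |X_{0j}|³`, for `X₀ ∼ ν`. -/
def gammaXMin {d : ℕ} (ν : Measure (EuclideanSpace ℝ (Fin d))) : ℝ :=
  ⨅ j : Fin d, ∫ x, |x j| ^ 3 ∂ν

/-- A real sequence is bounded from above. -/
def SeqBddAbove (f : ℕ → ℝ) : Prop := ∃ K : ℝ, ∀ᶠ n in atTop, f n ≤ K

/-- A real sequence is (eventually) bounded away from zero, on the positive side. -/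
def SeqAwayFromZero (f : ℕ → ℝ) : Prop := ∃ c : ℝ, 0 < c ∧ ∀ᶠ n in atTop, c ≤ f n

end

/-! Minimizing over `μ` first turns the problem into Huber regression, whose optimality condition in
`β` says that the residuals clipped at level `lam` are orthogonal to the covariates. In the given
regime one can guess which residuals are clipped: the first `s₁`, with the signs of `μs`. The guess
makes the condition linear, and it is solved by `βs + δ`, where the Gram operator of the remaining
covariates sends `δ` to the score `∑ εᵢ Xᵢ` plus a small bias. If `δ` is small, the guess is
consistent with itself and yields a dual certificate. By `IsPLSEstimate.eq_of_certificate` every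
estimate then equals `βs + δ`, so neither a preliminary consistency proof nor control of a random
clipping set is needed.

Replacing the Gram matrix by the covariance matrix gives `IsPLSEstimate.abs_linearization_le`. With
probability tending to one the score has norm at most `√n * d` and the Gram error is at most
`√(d³/n)`. Their product, after division by `√n`, is `√(d⁵/n)`, which is where the growth condition
on `d` enters; the conditions on `s₁` and `s₂` remove the bias.

Testing against `a = Σ⁻¹ Aᵀ t` reduces the inner product of `t` with the normalized estimation error
to a normalized i.i.d. sum of `ε ⟨X, a⟩`, with variance tending to `σ² tᵀ GX t`. A Lindeberg
argument (`tendsto_charFun_score`) gives its limit, `norm_integral_cexp_sub_le` transfers it to the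
estimator, and convergence of characteristic functions concludes. -/

/-! ### Deterministic analysis of the minimizer -/

/-- A dual certificate for the penalized least-squares problem: if the clipped residuals `u` at `b`
satisfy the normal equations, and the covariates with unclipped residual have full rank, then `b`
is the only possible penalized least-squares estimate. -/
lemma IsPLSEstimate.eq_of_certificate {n d : ℕ} {X : Fin n → EuclideanSpace ℝ (Fin d)}
    {Y : Fin n → ℝ} {lam : ℝ} {β b : EuclideanSpace ℝ (Fin d)} (h : IsPLSEstimate X Y lam β)
    (u : Fin n → ℝ) (hu : ∀ i, |u i| ≤ lam)
    (hr : ∀ i, lam * |Y i - inner ℝ (X i) b - u i| = u i * (Y i - inner ℝ (X i) b - u i))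
    (hnormal : ∑ i, u i • X i = 0)
    (hinj : ∀ w, (∀ i, |u i| < lam → inner ℝ (X i) w = 0) → w = 0) : β = b := by
  obtain ⟨μ, hμ⟩ := h
  have h1 := hμ (fun i => Y i - inner ℝ (X i) b - u i) b
  have hn : ∑ i, u i * inner ℝ (X i) (β - b) = 0 := by
    have : inner ℝ (∑ i, u i • X i) (β - b) = 0 := by rw [hnormal, inner_zero_left]
    simpa [sum_inner, real_inner_smul_left] using this
  have hnn : ∀ i ∈ Finset.univ, 0 ≤ (Y i - μ i - inner ℝ (X i) β - u i) ^ 2 +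
      2 * (lam * |μ i| - u i * μ i) := by
    intro i _
    have : u i * μ i ≤ lam * |μ i| :=
      (le_abs_self _).trans (by rw [abs_mul]; exact mul_le_mul_of_nonneg_right (hu i) (abs_nonneg _))
    have := sq_nonneg (Y i - μ i - inner ℝ (X i) β - u i)
    linarith
  have hsum : ∑ i, ((Y i - μ i - inner ℝ (X i) β - u i) ^ 2 +
      2 * (lam * |μ i| - u i * μ i)) ≤ 0 := by
    unfold plsLoss at h1
    -- The excess loss of `(μ, β)` over the candidate with `b`, written as a sum of nonnegative
    -- terms. The normal equations remove the cross term in `β - b`, and `hr` evaluates the penalty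
    -- of the candidate.
    have h2 : ∑ i, ((Y i - μ i - inner ℝ (X i) β - u i) ^ 2 + 2 * (lam * |μ i| - u i * μ i)) =
        (∑ i, (Y i - μ i - inner ℝ (X i) β) ^ 2 + ∑ i, 2 * lam * |μ i|) -
        (∑ i, (Y i - (Y i - inner ℝ (X i) b - u i) - inner ℝ (X i) b) ^ 2 +
          ∑ i, 2 * lam * |Y i - inner ℝ (X i) b - u i|) +
        2 * ∑ i, u i * inner ℝ (X i) (β - b) := by
      rw [Finset.mul_sum, ← Finset.sum_add_distrib, ← Finset.sum_add_distrib,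
        ← Finset.sum_sub_distrib, ← Finset.sum_add_distrib]
      refine Finset.sum_congr rfl fun i _ => ?_
      rw [inner_sub_right]
      linear_combination 2 * hr i
    rw [h2, hn]
    linarith
  have hz := (Finset.sum_eq_zero_iff_of_nonneg hnn).1
    (le_antisymm hsum (Finset.sum_nonneg hnn))
  rw [← sub_eq_zero]
  refine hinj _ fun i hi => ?_
  have h0 := hz i (Finset.mem_univ i)
  have hlt : u i * μ i ≤ |u i| * |μ i| := (le_abs_self _).trans (abs_mul _ _).le
  -- Where `|u i| < lam`, equality in `u μ ≤ lam |μ|` forces `μ i = 0`. Both `β` and `b` then have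
  -- residual `u i` there, so `β - b` is orthogonal to `X i`.
  have hμ0 : μ i = 0 := by
    by_contra hne
    have := mul_lt_mul_of_pos_right hi (abs_pos.2 hne)
    nlinarith [sq_nonneg (Y i - μ i - inner ℝ (X i) β - u i)]
  have hr0 : Y i - inner ℝ (X i) b - u i = 0 := by
    by_contra hne
    have h2 := mul_lt_mul_of_pos_right hi (abs_pos.2 hne)
    rw [hr i, ← abs_mul] at h2
    exact absurd (le_abs_self _) (not_le.2 h2)
  rw [hμ0] at h0
  have h3 : Y i - 0 - inner ℝ (X i) β - u i = 0 := by
    simpa using h0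
  rw [inner_sub_right]
  linarith

lemma sum_fin_indicator_le {n : ℕ} (s t : ℕ) :
    ∑ i : Fin n, (if s ≤ (i : ℕ) ∧ (i : ℕ) < s + t then (1 : ℝ) else 0) ≤ t := by
  rw [Fin.sum_univ_eq_sum_range (fun i => if s ≤ i ∧ i < s + t then (1 : ℝ) else 0),
    Finset.sum_boole]
  norm_cast
  calc _ ≤ (Finset.Ico s (s + t)).card := Finset.card_le_card fun i => by simp
    _ = t := by simp

/-- A coercive operator is injective, hence surjective in finite dimension. Coercivity with
Cauchy–Schwarz also bounds the inverse by `1 / m`. -/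
lemma exists_sum_inner_smul_eq {n d : ℕ} (X : Fin n → EuclideanSpace ℝ (Fin d))
    (I : Finset (Fin n)) {m : ℝ} (hm : 0 < m)
    (hI : ∀ w, m * ‖w‖ ^ 2 ≤ ∑ i ∈ I, inner ℝ (X i) w ^ 2) (v : EuclideanSpace ℝ (Fin d)) :
    ∃ δ, ∑ i ∈ I, inner ℝ (X i) δ • X i = v ∧ ‖δ‖ ≤ ‖v‖ / m := by
  let S : EuclideanSpace ℝ (Fin d) →ₗ[ℝ] EuclideanSpace ℝ (Fin d) :=
    ∑ i ∈ I, (innerₛₗ ℝ (X i)).smulRight (X i)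
  have hS : ∀ w, S w = ∑ i ∈ I, inner ℝ (X i) w • X i := fun w => by
    simp [S, LinearMap.sum_apply]
  have hSw : ∀ w, inner ℝ (S w) w = ∑ i ∈ I, inner ℝ (X i) w ^ 2 := fun w => by
    rw [hS, sum_inner]
    simp [real_inner_smul_left, sq]
  have key : ∀ w, m * ‖w‖ ≤ ‖S w‖ := fun w => by
    rcases eq_or_lt_of_le (norm_nonneg w) with h | h
    · rw [← h]; simp
    · have h1 := (hI w).trans ((hSw w).symm.le.trans (real_inner_le_norm _ _))
      exact le_of_mul_le_mul_right (by linarith) h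
  have hinj : Function.Injective S := by
    rw [injective_iff_map_eq_zero]
    intro w hw
    have := key w
    rw [hw, norm_zero] at this
    have := norm_nonneg w
    rw [← norm_eq_zero]
    nlinarith
  obtain ⟨δ, hδ⟩ := LinearMap.injective_iff_surjective.1 hinj v
  refine ⟨δ, by rw [← hS, hδ], ?_⟩
  rw [le_div_iff₀ hm, ← hδ, mul_comm]
  exact key δ

/-- Deterministic linearization of the penalized least-squares estimate on the event where the
covariates and the errors are well behaved. -/
lemma IsPLSEstimate.abs_linearization_le {n d : ℕ} (hn : 0 < n)
    {X : Fin n → EuclideanSpace ℝ (Fin d)} {Y ε μs : Fin n → ℝ}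
    {βs β : EuclideanSpace ℝ (Fin d)} {s₁ s₂ : ℕ} {κ γ lam c D T : ℝ}
    (B : EuclideanSpace ℝ (Fin d) → EuclideanSpace ℝ (Fin d) → ℝ)
    (hc : 0 < c) (hκ : 0 ≤ κ) (hγ : 0 ≤ γ) (hD0 : 0 ≤ D) (hlam0 : 0 < lam) (hγlam : γ ≤ lam)
    (hY : ∀ i, Y i = μs i + inner ℝ (X i) βs + ε i)
    (hβ : IsPLSEstimate X Y lam β)
    (hBpos : ∀ w, c * ‖w‖ ^ 2 ≤ B w w)
    (hB : ∀ w w', |(n : ℝ)⁻¹ * ∑ i, inner ℝ (X i) w * inner ℝ (X i) w' - B w w'| ≤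
      D * ‖w‖ * ‖w'‖)
    (hX : ∀ i, ‖X i‖ ≤ κ) (hε : ∀ i, |ε i| ≤ γ) (hT : ‖∑ i, ε i • X i‖ ≤ √n * T)
    (hμ₁ : ∀ i : Fin n, (i : ℕ) < s₁ → 3 * lam ≤ |μs i|)
    (hμ₂ : ∀ i : Fin n, s₁ ≤ (i : ℕ) → (i : ℕ) < s₁ + s₂ → |μs i| ≤ γ)
    (hμ₃ : ∀ i : Fin n, s₁ + s₂ ≤ (i : ℕ) → μs i = 0)
    (hD : D + s₁ * κ ^ 2 / n ≤ c / 2)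
    (hlam : 2 * γ + κ * (2 / c * (T + (2 * s₁ * lam * κ + s₂ * γ * κ) / √n) / √n) < lam)
    (a : EuclideanSpace ℝ (Fin d)) :
    |√n * B a (β - βs) - (√n)⁻¹ * ∑ i, ε i * inner ℝ (X i) a| ≤
      ‖a‖ * ((2 * s₁ * lam * κ + s₂ * γ * κ) / √n +
        (D + s₁ * κ ^ 2 / n) * (2 / c * (T + (2 * s₁ * lam * κ + s₂ * γ * κ) / √n))) := by
  classical
  have hn' : (0 : ℝ) < n := by exact_mod_cast hn
  have hsn : 0 < √(n : ℝ) := Real.sqrt_pos.2 hn'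
  have hsq : √(n : ℝ) * √n = n := Real.mul_self_sqrt hn'.le
  set ρ : ℝ := 2 * s₁ * lam * κ + s₂ * γ * κ with hρ
  set D' : ℝ := D + s₁ * κ ^ 2 / n with hD'
  have hD'0 : 0 ≤ D' := by positivity
  set R : ℝ := 2 / c * (T + ρ / √n) / √n with hR
  let I : Finset (Fin n) := Finset.univ.filter fun i => s₁ ≤ (i : ℕ)
  -- Dropping the `s₁` clipped observations perturbs the normalized Gram form by at most `s₁ κ² /
  -- n`, which is why `D'` replaces `D`.
  have hI : ∀ w w', |∑ i ∈ I, inner ℝ (X i) w * inner ℝ (X i) w' - n * B w w'| ≤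
      n * D' * ‖w‖ * ‖w'‖ := by
    intro w w'
    have hsplit := Finset.sum_filter_add_sum_filter_not Finset.univ
      (fun i : Fin n => s₁ ≤ (i : ℕ)) (fun i => inner ℝ (X i) w * inner ℝ (X i) w')
    have h1 : |∑ i with ¬ s₁ ≤ (i : Fin n).val, inner ℝ (X i) w * inner ℝ (X i) w'| ≤
        s₁ * (κ * ‖w‖ * (κ * ‖w'‖)) := by
      refine (Finset.abs_sum_le_sum_abs _ _).trans ?_
      rw [Finset.sum_filter]
      calc _ ≤ ∑ i : Fin n, (if 0 ≤ (i : ℕ) ∧ (i : ℕ) < 0 + s₁ then (1 : ℝ) else 0) *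
            (κ * ‖w‖ * (κ * ‖w'‖)) := by
            refine Finset.sum_le_sum fun i _ => ?_
            by_cases hi : (i : ℕ) < s₁
            · simp only [not_le, hi, if_true, zero_le, zero_add, true_and, one_mul, abs_mul]
              have e1 := (abs_real_inner_le_norm (X i) w).trans
                (mul_le_mul_of_nonneg_right (hX i) (norm_nonneg w))
              have e2 := (abs_real_inner_le_norm (X i) w').trans
                (mul_le_mul_of_nonneg_right (hX i) (norm_nonneg w'))
              exact mul_le_mul e1 e2 (abs_nonneg _) (by positivity)
            · simp [hi]
        _ ≤ _ := by
            rw [← Finset.sum_mul]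
            exact mul_le_mul_of_nonneg_right (sum_fin_indicator_le 0 s₁) (by positivity)
    have h2 := mul_le_mul_of_nonneg_left (hB w w') hn'.le
    rw [← abs_of_pos hn', ← abs_mul, abs_of_pos hn', mul_sub, mul_inv_cancel_left₀ hn'.ne'] at h2
    have h3 : n * D' * ‖w‖ * ‖w'‖ = n * (D * ‖w‖ * ‖w'‖) + s₁ * (κ * ‖w‖ * (κ * ‖w'‖)) := by
      rw [hD']; field_simp
    rw [h3]
    rw [abs_le] at h1 h2 ⊢
    constructor <;> linarith [h1.1, h1.2, h2.1, h2.2]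
  -- The bias: what must be added to `ε i` to obtain the guessed clipped residual, apart from the
  -- term in `δ`. It vanishes beyond `s₁ + s₂`.
  let e : Fin n → ℝ := fun i =>
    if (i : ℕ) < s₁ then SignType.sign (μs i) * lam - ε i else μs i
  have hrem : ‖∑ i, e i • X i‖ ≤ ρ := by
    have he : ∀ i, |e i| ≤ (if 0 ≤ (i : ℕ) ∧ (i : ℕ) < 0 + s₁ then (1 : ℝ) else 0) * (2 * lam) +
        (if s₁ ≤ (i : ℕ) ∧ (i : ℕ) < s₁ + s₂ then (1 : ℝ) else 0) * γ := by
      intro i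
      by_cases h1 : (i : ℕ) < s₁
      · have h3 : |(SignType.sign (μs i) : ℝ) * lam| ≤ lam := by
          rw [abs_mul, abs_of_pos hlam0]
          have : |((SignType.sign (μs i) : SignType) : ℝ)| ≤ 1 := by
            cases SignType.sign (μs i) <;> simp
          nlinarith
        have h4 := abs_sub (SignType.sign (μs i) * lam) (ε i)
        have h5 := hε i
        simp only [e, h1, if_true, zero_le, zero_add, true_and, not_le.2 h1, false_and, if_false]
        linarith
      · by_cases h2 : (i : ℕ) < s₁ + s₂
        · simpa [e, h1, h2, not_lt.1 h1] using hμ₂ i (not_lt.1 h1) h2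
        · simp [e, h1, h2, hμ₃ i (not_lt.1 h2)]
    calc ‖∑ i, e i • X i‖ ≤ ∑ i, |e i| * κ := by
          refine (norm_sum_le _ _).trans (Finset.sum_le_sum fun i _ => ?_)
          rw [norm_smul, Real.norm_eq_abs]
          exact mul_le_mul_of_nonneg_left (hX i) (abs_nonneg _)
      _ ≤ (s₁ * (2 * lam) + s₂ * γ) * κ := by
          rw [← Finset.sum_mul]
          refine mul_le_mul_of_nonneg_right ((Finset.sum_le_sum fun i _ => he i).trans ?_) hκ
          rw [Finset.sum_add_distrib, ← Finset.sum_mul, ← Finset.sum_mul]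
          gcongr
          · exact sum_fin_indicator_le 0 s₁
          · exact sum_fin_indicator_le s₁ s₂
      _ = ρ := by rw [hρ]; ring
  -- Since `D' ≤ c / 2`, the Gram form over `I` keeps half of the coercivity of `B`.
  obtain ⟨δ, hδ, hδn⟩ := exists_sum_inner_smul_eq X I (m := n * (c / 2)) (by positivity)
    (fun w => by
      have h1 := (abs_le.1 (hI w w)).1
      have h2 := mul_le_mul_of_nonneg_left (hBpos w) hn'.le
      have h3 : n * D' * ‖w‖ * ‖w‖ ≤ n * (c / 2) * ‖w‖ * ‖w‖ := by gcongr
      simp only [sq] at h2 ⊢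
      linarith) (∑ i, ε i • X i + ∑ i, e i • X i)
  have hδR : ‖δ‖ ≤ R := by
    refine hδn.trans ?_
    have h1 : R = (√n * T + ρ) / (n * (c / 2)) := by
      have aux : ∀ x N : ℝ, 0 < x → x * x = N →
          2 / c * (T + ρ / x) / x = (x * T + ρ) / (N * (c / 2)) := by
        rintro x _ hx rfl
        field_simp
      exact aux _ _ hsn hsq
    rw [h1]
    gcongr
    exact (norm_add_le _ _).trans (add_le_add hT hrem)
  have hXδ : ∀ i, |inner ℝ (X i) δ| ≤ κ * R := fun i =>
    (abs_real_inner_le_norm _ _).trans (mul_le_mul (hX i) hδR (norm_nonneg _) hκ)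
  have hres : ∀ i, Y i - inner ℝ (X i) (βs + δ) = μs i + ε i - inner ℝ (X i) δ := fun i => by
    rw [hY, inner_add_right]; ring
  let u : Fin n → ℝ := fun i =>
    if (i : ℕ) < s₁ then SignType.sign (μs i) * lam else μs i + ε i - inner ℝ (X i) δ
  have hu_small : ∀ i : Fin n, s₁ ≤ (i : ℕ) → |u i| < lam := by
    intro i hi
    have h1 : |μs i| ≤ γ := by
      by_cases h2 : (i : ℕ) < s₁ + s₂
      · exact hμ₂ i hi h2
      · simpa [hμ₃ i (not_lt.1 h2)] using hγ
    simp only [u, not_lt.2 hi, if_false]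
    have h2 := hε i
    have h3 := hXδ i
    rw [abs_le] at h1 h2 h3
    rw [abs_lt]
    constructor <;> linarith [h1.1, h1.2, h2.1, h2.2, h3.1, h3.2]
  have hβ' : β = βs + δ := by
    refine hβ.eq_of_certificate u (fun i => ?_) (fun i => ?_) ?_ fun w hw => ?_
    · by_cases hi : (i : ℕ) < s₁
      · simp only [u, hi, if_true, abs_mul, abs_of_pos hlam0]
        have : |((SignType.sign (μs i) : SignType) : ℝ)| ≤ 1 := by
          cases SignType.sign (μs i) <;> simp
        nlinarith
      · exact (hu_small i (not_lt.1 hi)).le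
    · rw [hres]
      by_cases hi : (i : ℕ) < s₁
      -- The factor 3 is used here: clipping removes `lam`, and noise and fit together remove less
      -- than `lam`, so what remains still has the sign of `μs i`.
      · have h1 := hμ₁ i hi
        have h2 := hε i
        have h3 := hXδ i
        rw [abs_le] at h2 h3
        simp only [u, hi, if_true]
        rcases lt_trichotomy (μs i) 0 with h | h | h
        · rw [abs_of_neg h] at h1
          rw [sign_neg h, abs_of_neg]
          · simp; ring
          · simp; linarith
        · rw [h, abs_zero] at h1
          linarith
        · rw [abs_of_pos h] at h1
          rw [sign_pos h, abs_of_pos]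
          · simp
          · simp; linarith
      · simp [u, hi]
    · have h1 : ∑ i, u i • X i = ∑ i, ε i • X i + ∑ i, e i • X i -
          ∑ i ∈ I, inner ℝ (X i) δ • X i := by
        rw [Finset.sum_filter, ← Finset.sum_add_distrib, ← Finset.sum_sub_distrib]
        refine Finset.sum_congr rfl fun i _ => ?_
        by_cases hi : (i : ℕ) < s₁
        · simp only [u, e, hi, not_le.2 hi, if_true, if_false, sub_zero, ← add_smul]
          congr 1; ring
        · simp only [u, e, hi, not_lt.1 hi, if_true, if_false, ← add_smul, ← sub_smul]
          congr 1; ring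
      rw [h1, hδ, sub_self]
    -- The unclipped indices include all of `I`, on which the Gram form is already coercive.
    · have h1 := (abs_le.1 (hI w w)).1
      have h2 := mul_le_mul_of_nonneg_left (hBpos w) hn'.le
      have h3 : n * D' * ‖w‖ * ‖w‖ ≤ n * (c / 2) * ‖w‖ * ‖w‖ := by gcongr
      rw [Finset.sum_eq_zero fun i hi => by
        rw [hw i (hu_small i (Finset.mem_filter.1 hi).2), zero_mul]] at h1
      have h4 : n * (c / 2) * ‖w‖ ^ 2 ≤ 0 := by
        simp only [sq] at h2 ⊢
        linarith
      have h5 : 0 < n * (c / 2) := by positivity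
      have h6 : ‖w‖ ^ 2 = 0 := le_antisymm (by
        by_contra h; push Not at h; nlinarith [mul_pos h5 h]) (sq_nonneg _)
      simpa using h6
  have hβδ : β - βs = δ := by rw [hβ', add_sub_cancel_left]
  rw [hβδ]
  have h1 : ∑ i ∈ I, inner ℝ (X i) a * inner ℝ (X i) δ =
      ∑ i, ε i * inner ℝ (X i) a + inner ℝ (∑ i, e i • X i) a := by
    have h2 : inner ℝ (∑ i ∈ I, inner ℝ (X i) δ • X i) a =
        inner ℝ (∑ i, ε i • X i + ∑ i, e i • X i) a := by rw [hδ]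
    rw [inner_add_left, sum_inner, sum_inner] at h2
    simp only [real_inner_smul_left] at h2
    rw [← h2]
    exact Finset.sum_congr rfl fun i _ => mul_comm _ _
  have h2 := hI a δ
  rw [h1] at h2
  have h3 : |inner ℝ (∑ i, e i • X i) a| ≤ ρ * ‖a‖ :=
    (abs_real_inner_le_norm _ _).trans (mul_le_mul_of_nonneg_right hrem (norm_nonneg _))
  have h4 : n * D' * ‖a‖ * ‖δ‖ ≤ n * D' * ‖a‖ * R :=
    mul_le_mul_of_nonneg_left hδR (by positivity)
  have h5 : √n * B a δ - (√n)⁻¹ * ∑ i, ε i * inner ℝ (X i) a =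
      (√n)⁻¹ * (n * B a δ - ∑ i, ε i * inner ℝ (X i) a) := by
    have aux : ∀ x N y z : ℝ, 0 < x → x * x = N → x * y - x⁻¹ * z = x⁻¹ * (N * y - z) := by
      rintro x _ y z hx rfl
      field_simp
    exact aux _ _ _ _ hsn hsq
  rw [h5, abs_mul, abs_of_pos (inv_pos.2 hsn)]
  have h6 : ‖a‖ * (ρ / √n + D' * (2 / c * (T + ρ / √n))) =
      (√n)⁻¹ * (n * D' * ‖a‖ * R + ρ * ‖a‖) := by
    have aux : ∀ x N : ℝ, 0 < x → x * x = N →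
        ‖a‖ * (ρ / x + D' * (2 / c * (T + ρ / x))) =
          x⁻¹ * (N * D' * ‖a‖ * (2 / c * (T + ρ / x) / x) + ρ * ‖a‖) := by
      rintro x _ hx rfl
      field_simp
      ring
    exact aux _ _ hsn hsq
  rw [h6]
  refine mul_le_mul_of_nonneg_left ?_ (inv_pos.2 hsn).le
  rw [abs_le] at h2 h3 ⊢
  constructor <;> linarith [h2.1, h2.2, h3.1, h3.2]

/-! ### Independence of the pairs and second moments of i.i.d. sums -/

lemma hasLaw_pi_prodMk {Ω ι E F : Type*} [MeasurableSpace Ω] [MeasurableSpace E]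
    [MeasurableSpace F] [Fintype ι] {P : Measure Ω} [IsProbabilityMeasure P]
    {μ : Measure E} {ν : Measure F} [IsProbabilityMeasure μ] [IsProbabilityMeasure ν]
    {X : ι → Ω → E} {Y : ι → Ω → F} (hX : ∀ i, HasLaw (X i) μ P) (hY : ∀ i, HasLaw (Y i) ν P)
    (hXi : iIndepFun X P) (hYi : iIndepFun Y P)
    (h : IndepFun (fun ω i => X i ω) (fun ω i => Y i ω) P) :
    HasLaw (fun ω i => (X i ω, Y i ω)) (Measure.pi fun _ : ι => μ.prod ν) P := by
  have h1 := h.hasLaw_prod (hXi.hasLaw_pi hX) (hYi.hasLaw_pi hY)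
  have h2 := (measurePreserving_arrowProdEquivProdArrow E F ι (fun _ => μ) (fun _ => ν)).symm
  exact h2.fun_comp_hasLaw h1

lemma hasLaw_prodMk_of_pi {Ω ι E F : Type*} [MeasurableSpace Ω] [MeasurableSpace E]
    [MeasurableSpace F] [Fintype ι] {P : Measure Ω} [IsProbabilityMeasure P]
    {μ : Measure E} {ν : Measure F} [IsProbabilityMeasure μ] [IsProbabilityMeasure ν]
    {X : ι → Ω → E} {Y : ι → Ω → F} (hX : ∀ i, HasLaw (X i) μ P) (hY : ∀ i, HasLaw (Y i) ν P)
    (hXi : iIndepFun X P) (hYi : iIndepFun Y P)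
    (h : IndepFun (fun ω i => X i ω) (fun ω i => Y i ω) P) (i : ι) :
    HasLaw (fun ω => (X i ω, Y i ω)) (μ.prod ν) P :=
  (measurePreserving_eval (fun _ : ι => μ.prod ν) i).fun_comp_hasLaw
    (hasLaw_pi_prodMk hX hY hXi hYi h)

/-- Independence within each family and between the two families gives the full product law;
regrouping its coordinates makes the pairs (covariate, error) i.i.d. -/
lemma iIndepFun_prodMk {Ω ι E F : Type*} [MeasurableSpace Ω] [MeasurableSpace E]
    [MeasurableSpace F] [Fintype ι] {P : Measure Ω} [IsProbabilityMeasure P]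
    {μ : Measure E} {ν : Measure F} [IsProbabilityMeasure μ] [IsProbabilityMeasure ν]
    {X : ι → Ω → E} {Y : ι → Ω → F} (hX : ∀ i, HasLaw (X i) μ P) (hY : ∀ i, HasLaw (Y i) ν P)
    (hXi : iIndepFun X P) (hYi : iIndepFun Y P)
    (h : IndepFun (fun ω i => X i ω) (fun ω i => Y i ω) P) :
    iIndepFun (fun i ω => (X i ω, Y i ω)) P :=
  (iIndepFun_iff_hasLaw_pi_pi (hasLaw_prodMk_of_pi hX hY hXi hYi h)).2
    (hasLaw_pi_prodMk hX hY hXi hYi h)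

lemma integral_sq_sum_of_iIndepFun {Ω ι E : Type*} [MeasurableSpace Ω] [MeasurableSpace E]
    [Fintype ι] {P : Measure Ω} [IsProbabilityMeasure P] {ρ : Measure E} [IsProbabilityMeasure ρ]
    {Z : ι → Ω → E} (hZ : ∀ i, HasLaw (Z i) ρ P) (hZi : iIndepFun Z P) {f : E → ℝ}
    (hfm : Measurable f) (hf : MemLp f 2 ρ) (hf0 : ∫ z, f z ∂ρ = 0) :
    MemLp (fun ω => ∑ i, f (Z i ω)) 2 P ∧
      ∫ ω, (∑ i, f (Z i ω)) ^ 2 ∂P = Fintype.card ι * ∫ z, f z ^ 2 ∂ρ := by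
  have hL : ∀ i, MemLp (fun ω => f (Z i ω)) 2 P := fun i => by
    have := (hZ i).map_eq ▸ hf
    exact this.comp_of_map (hZ i).aemeasurable
  have h0 : ∀ i, ∫ ω, f (Z i ω) ∂P = 0 := fun i => by
    rw [← hf0, ← (hZ i).integral_comp hf.aestronglyMeasurable]; rfl
  have hS : MemLp (fun ω => ∑ i, f (Z i ω)) 2 P := memLp_finsetSum _ fun i _ => hL i
  refine ⟨hS, ?_⟩
  have hS0 : ∫ ω, ∑ i, f (Z i ω) ∂P = 0 := by
    rw [integral_finsetSum _ fun i _ => (hL i).integrable (by norm_num)]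
    simp [h0]
  rw [← variance_of_integral_eq_zero hS.aemeasurable hS0]
  have h1 := IndepFun.variance_sum (μ := P) (X := fun i ω => f (Z i ω)) (s := Finset.univ)
    (fun i _ => hL i) (fun i _ j _ hij => (hZi.indepFun hij).comp hfm hfm)
  have h2 : (∑ i, fun ω => f (Z i ω)) = fun ω => ∑ i, f (Z i ω) := by
    ext ω; simp
  rw [h2] at h1
  rw [h1]
  have h3 : ∀ i, Var[fun ω => f (Z i ω); P] = ∫ z, f z ^ 2 ∂ρ := fun i => by
    rw [variance_of_integral_eq_zero (hL i).aemeasurable (h0 i)]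
    exact (hZ i).integral_comp (hf.aestronglyMeasurable.pow 2)
  simp [h3]

/-- A Chebyshev inequality for the Euclidean norm of a sum of i.i.d. centered vectors. -/
lemma measure_lt_sum_sq_sum_le {Ω ι E K : Type*} [MeasurableSpace Ω] [MeasurableSpace E]
    [Fintype ι] [Fintype K] {P : Measure Ω} [IsProbabilityMeasure P] {ρ : Measure E}
    [IsProbabilityMeasure ρ] {Z : ι → Ω → E} (hZ : ∀ i, HasLaw (Z i) ρ P) (hZi : iIndepFun Z P)
    {f : K → E → ℝ} (hfm : ∀ k, Measurable (f k)) (hf : ∀ k, MemLp (f k) 2 ρ)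
    (hf0 : ∀ k, ∫ z, f k z ∂ρ = 0) {r : ℝ} (hr : 0 < r) :
    P {ω | r < ∑ k, (∑ i, f k (Z i ω)) ^ 2} ≤
      ENNReal.ofReal (Fintype.card ι * (∑ k, ∫ z, f k z ^ 2 ∂ρ) / r) := by
  have h := fun k => integral_sq_sum_of_iIndepFun hZ hZi (hfm k) (hf k) (hf0 k)
  have hint : Integrable (fun ω => ∑ k, (∑ i, f k (Z i ω)) ^ 2) P :=
    integrable_finsetSum _ fun k _ => (h k).1.integrable_sq
  have hM := mul_meas_ge_le_integral_of_nonneg (μ := P)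
    (f := fun ω => ∑ k, (∑ i, f k (Z i ω)) ^ 2)
    (Eventually.of_forall fun ω => Finset.sum_nonneg fun k _ => sq_nonneg _) hint r
  rw [integral_finsetSum _ fun k _ => (h k).1.integrable_sq] at hM
  simp only [(h _).2] at hM
  rw [← Finset.mul_sum] at hM
  calc P {ω | r < ∑ k, (∑ i, f k (Z i ω)) ^ 2}
      ≤ P {ω | r ≤ ∑ k, (∑ i, f k (Z i ω)) ^ 2} := measure_mono fun ω (hω : r < _) => hω.le
    _ = ENNReal.ofReal (P.real {ω | r ≤ ∑ k, (∑ i, f k (Z i ω)) ^ 2}) := by simp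
    _ ≤ _ := by
      refine ENNReal.ofReal_le_ofReal ?_
      rw [le_div_iff₀ hr, mul_comm]
      exact hM

/-! ### Lindeberg limit of characteristic functions -/

/-- For `|y| ≤ 1` this is the cubic Taylor remainder; for larger `y` each term is bounded
separately. The minimum is what allows a limit theorem with second moments only. -/
lemma norm_cexp_I_mul_sub_taylor_le (y : ℝ) :
    ‖Complex.exp (y * Complex.I) - 1 - y * Complex.I + y ^ 2 / 2‖ ≤ 4 * (y ^ 2 * min 1 |y|) := by
  have hy : ‖(y * Complex.I : ℂ)‖ = |y| := by simp
  rcases le_or_gt |y| 1 with h | h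
  · rw [min_eq_right h]
    have h1 := Complex.exp_bound (x := y * Complex.I) (by rwa [hy]) (n := 3) (by norm_num)
    rw [hy] at h1
    simp only [Finset.sum_range_succ, Finset.sum_range_zero] at h1
    have h2 : Complex.exp (y * Complex.I) - 1 - y * Complex.I + y ^ 2 / 2 =
        Complex.exp (y * Complex.I) - (0 + (y * Complex.I) ^ 0 / (Nat.factorial 0 : ℂ) +
          (y * Complex.I) ^ 1 / (Nat.factorial 1 : ℂ) +
          (y * Complex.I) ^ 2 / (Nat.factorial 2 : ℂ)) := by
      simp [mul_pow]; ring
    rw [h2]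
    refine h1.trans ?_
    have h3 : |y| ^ 3 = y ^ 2 * |y| := by rw [← sq_abs]; ring
    rw [h3]
    have : 0 ≤ y ^ 2 * |y| := by positivity
    norm_num [Nat.factorial]
    linarith
  · rw [min_eq_left h.le, mul_one]
    have h1 : ‖(y ^ 2 / 2 : ℂ)‖ = y ^ 2 / 2 := by simp
    have h2 := norm_add_le (Complex.exp (y * Complex.I) - 1 - y * Complex.I) (y ^ 2 / 2 : ℂ)
    have h3 := norm_sub_le (Complex.exp (y * Complex.I) - 1) (y * Complex.I)
    have h4 := norm_sub_le (Complex.exp (y * Complex.I)) 1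
    rw [Complex.norm_exp_ofReal_mul_I, norm_one] at h4
    rw [hy] at h3
    rw [h1] at h2
    have := sq_abs y
    nlinarith

/-- A Lindeberg central limit theorem for the characteristic functions of row sums of triangular
arrays with i.i.d. rows. -/
lemma tendsto_charFun_inv_sqrt_pow {ρ : ℕ → Measure ℝ} [∀ n, IsProbabilityMeasure (ρ n)] {v : ℝ}
    (hL : ∀ n, MemLp id 2 (ρ n)) (h0 : ∀ n, ∫ x, x ∂(ρ n) = 0)
    (hv : Tendsto (fun n => ∫ x, x ^ 2 ∂(ρ n)) atTop (𝓝 v))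
    (hlind : Tendsto (fun n : ℕ => ∫ x, x ^ 2 * min 1 |(√(n : ℝ))⁻¹ * x| ∂(ρ n)) atTop (𝓝 0)) :
    Tendsto (fun n : ℕ => charFun (ρ n) (√(n : ℝ))⁻¹ ^ n) atTop (𝓝 (Complex.exp (-v / 2))) := by
  -- Integrated Taylor expansion: the linear term vanishes by centering, and `n s² = 1` normalizes
  -- the quadratic one. Because the rows are i.i.d., `(1 + z / n) ^ n → exp z` then suffices.
  have key : ∀ n : ℕ, 0 < n → ‖(n : ℂ) * (charFun (ρ n) (√(n : ℝ))⁻¹ - 1) +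
      ((∫ x, x ^ 2 ∂(ρ n) : ℝ) : ℂ) / 2‖ ≤ 4 * ∫ x, x ^ 2 * min 1 |(√(n : ℝ))⁻¹ * x| ∂(ρ n) := by
    intro n hn
    have hn' : (0 : ℝ) < n := by exact_mod_cast hn
    set s : ℝ := (√(n : ℝ))⁻¹ with hs
    have hs2 : n * s ^ 2 = 1 := by
      rw [hs, inv_pow, Real.sq_sqrt hn'.le, mul_inv_cancel₀ hn'.ne']
    have hx2 : Integrable (fun x : ℝ => x ^ 2) (ρ n) := (hL n).integrable_sq
    have hx1 : Integrable (fun x : ℝ => x) (ρ n) := (hL n).integrable (by norm_num)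
    have hexp : Integrable (fun x : ℝ => Complex.exp ((s * x : ℝ) * Complex.I)) (ρ n) := by
      refine Integrable.of_bound (by fun_prop) 1 (Eventually.of_forall fun x => ?_)
      rw [Complex.norm_exp_ofReal_mul_I]
    have hmin : Integrable (fun x : ℝ => x ^ 2 * min 1 |s * x|) (ρ n) := by
      refine hx2.mono (by fun_prop) (Eventually.of_forall fun x => ?_)
      rw [norm_mul]
      refine mul_le_of_le_one_right (norm_nonneg _) ?_
      rw [Real.norm_eq_abs, abs_of_nonneg (by positivity)]
      exact min_le_left _ _
    have hchar : charFun (ρ n) s = ∫ x, Complex.exp ((s * x : ℝ) * Complex.I) ∂(ρ n) := by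
      rw [charFun_apply_real]
      simp
    have heq : (n : ℂ) * (charFun (ρ n) s - 1) + ((∫ x, x ^ 2 ∂(ρ n) : ℝ) : ℂ) / 2 =
        ∫ x, n * (Complex.exp ((s * x : ℝ) * Complex.I) - 1 - (s * x : ℝ) * Complex.I +
          ((s * x : ℝ) : ℂ) ^ 2 / 2) ∂(ρ n) := by
      have e1 : Integrable (fun x : ℝ => ((s * x : ℝ) : ℂ) * Complex.I) (ρ n) :=
        (hx1.const_mul s).ofReal.mul_const _
      have e2 : Integrable (fun x : ℝ => ((s * x : ℝ) : ℂ) ^ 2 / 2) (ρ n) := by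
        have := ((hx2.const_mul (s ^ 2)).ofReal (𝕜 := ℂ)).div_const 2
        refine this.congr (Eventually.of_forall fun x => ?_)
        simp; ring
      have e6 : Integrable (fun x : ℝ => Complex.exp ((s * x : ℝ) * Complex.I) - 1) (ρ n) :=
        hexp.sub (integrable_const _)
      have e7 : Integrable (fun x : ℝ => Complex.exp ((s * x : ℝ) * Complex.I) - 1 -
        (s * x : ℝ) * Complex.I) (ρ n) := e6.sub e1
      rw [integral_const_mul, integral_add e7 e2, integral_sub e6 e1,
        integral_sub hexp (integrable_const _), ← hchar]
      have e3 : ∫ x, ((s * x : ℝ) : ℂ) * Complex.I ∂(ρ n) = 0 := by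
        rw [integral_mul_const, integral_complex_ofReal, integral_const_mul, h0]
        simp
      have e4 : ∫ x, ((s * x : ℝ) : ℂ) ^ 2 / 2 ∂(ρ n) =
          ((s ^ 2 * ∫ x, x ^ 2 ∂(ρ n) : ℝ) : ℂ) / 2 := by
        rw [integral_div, ← integral_const_mul, ← integral_complex_ofReal]
        congr 2
        ext x
        simp; ring
      have e5 : (n : ℂ) * (s : ℂ) ^ 2 = 1 := by exact_mod_cast hs2
      rw [e3, e4]
      simp only [integral_const, probReal_univ, one_smul]
      push_cast
      linear_combination (-((∫ x, x ^ 2 ∂(ρ n) : ℝ) : ℂ) / 2) * e5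
    rw [heq, ← integral_const_mul]
    refine norm_integral_le_of_norm_le (hmin.const_mul 4) (Eventually.of_forall fun x => ?_)
    rw [norm_mul, Complex.norm_natCast]
    calc _ ≤ (n : ℝ) * (4 * ((s * x) ^ 2 * min 1 |s * x|)) :=
          mul_le_mul_of_nonneg_left (norm_cexp_I_mul_sub_taylor_le _) hn'.le
      _ = 4 * (x ^ 2 * min 1 |s * x|) := by
          linear_combination (4 * x ^ 2 * min 1 |s * x|) * hs2
  have hlim : Tendsto (fun n : ℕ => (n : ℂ) * (charFun (ρ n) (√(n : ℝ))⁻¹ - 1)) atTop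
      (𝓝 (-v / 2)) := by
    have h1 : Tendsto (fun n : ℕ => (n : ℂ) * (charFun (ρ n) (√(n : ℝ))⁻¹ - 1) +
      ((∫ x, x ^ 2 ∂(ρ n) : ℝ) : ℂ) / 2) atTop (𝓝 0) := by
      refine squeeze_zero_norm' (eventually_gt_atTop 0 |>.mono key) ?_
      simpa using hlind.const_mul 4
    have h2 : Tendsto (fun n => ((∫ x, x ^ 2 ∂(ρ n) : ℝ) : ℂ) / 2) atTop (𝓝 ((v : ℂ) / 2)) :=
      ((Complex.continuous_ofReal.tendsto v).comp hv).div_const 2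
    have h3 := h1.sub h2
    simp only [add_sub_cancel_right, zero_sub, ← neg_div] at h3
    exact h3
  have := Complex.tendsto_one_add_pow_exp_of_tendsto hlim
  simpa using this

/-! ### Moments of the covariates -/

lemma integral_mul_le_sqrt_mul_sqrt {Ω : Type*} [MeasurableSpace Ω] {P : Measure Ω} {f g : Ω → ℝ}
    (hf : MemLp f 2 P) (hg : MemLp g 2 P) (hf0 : ∀ x, 0 ≤ f x) (hg0 : ∀ x, 0 ≤ g x) :
    ∫ x, f x * g x ∂P ≤ √(∫ x, f x ^ 2 ∂P) * √(∫ x, g x ^ 2 ∂P) := by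
  have h := integral_mul_le_Lp_mul_Lq_of_nonneg (μ := P) (p := 2) (q := 2)
    Real.HolderConjugate.two_two (Eventually.of_forall hf0) (Eventually.of_forall hg0)
    (by simpa using hf) (by simpa using hg)
  simpa [Real.sqrt_eq_rpow] using h

section Moments

variable {d : ℕ} {ν : Measure (EuclideanSpace ℝ (Fin d))}

lemma memLp_mul_coord (h4 : ∀ j, MemLp (fun x : EuclideanSpace ℝ (Fin d) => x j) 4 ν)
    (j k : Fin d) : MemLp (fun x : EuclideanSpace ℝ (Fin d) => x j * x k) 2 ν := by
  have : ENNReal.HolderTriple 4 4 2 := ⟨by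
    rw [← two_mul, show (4 : ENNReal) = 2 * 2 by norm_num, ENNReal.mul_inv (by simp) (by simp),
      ← mul_assoc, ENNReal.mul_inv_cancel (by simp) (by simp), one_mul]⟩
  exact (h4 k).mul (r := 2) (h4 j)

lemma memLp_sq_coord (h4 : ∀ j, MemLp (fun x : EuclideanSpace ℝ (Fin d) => x j) 4 ν) (j : Fin d) :
    MemLp (fun x : EuclideanSpace ℝ (Fin d) => x j ^ 2) 2 ν := by
  simpa [sq] using memLp_mul_coord h4 j j

lemma integral_sq_mul_sq_le (h4 : ∀ j, MemLp (fun x : EuclideanSpace ℝ (Fin d) => x j) 4 ν)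
    (j k : Fin d) :
    ∫ x, x j ^ 2 * x k ^ 2 ∂ν ≤ √(∫ x, (x j) ^ 4 ∂ν) * √(∫ x, (x k) ^ 4 ∂ν) := by
  have h := integral_mul_le_sqrt_mul_sqrt (memLp_sq_coord h4 j) (memLp_sq_coord h4 k)
    (fun x => sq_nonneg _) (fun x => sq_nonneg _)
  simpa only [← pow_mul, Nat.reduceMul] using h

lemma integral_sq_coord_le [IsProbabilityMeasure ν] (h4 : ∀ j, MemLp (fun x : EuclideanSpace ℝ (Fin d) => x j) 4 ν)
    (j : Fin d) : ∫ x, x j ^ 2 ∂ν ≤ √(∫ x, (x j) ^ 4 ∂ν) := by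
  have h := integral_mul_le_sqrt_mul_sqrt (memLp_sq_coord h4 j) (memLp_const (1 : ℝ))
    (fun x => sq_nonneg _) (fun x => zero_le_one)
  simpa [← pow_mul] using h

lemma sum_sqrt_fourth_moment_eq (hd : 0 < d) :
    ∑ j : Fin d, √(∫ x, (x j) ^ 4 ∂ν) = d * kappaX ν := by
  rw [kappaX, mul_inv_cancel_left₀ (by positivity)]

lemma sum_integral_sq_coord_le [IsProbabilityMeasure ν] (hd : 0 < d)
    (h4 : ∀ j, MemLp (fun x : EuclideanSpace ℝ (Fin d) => x j) 4 ν) :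
    ∑ j, ∫ x, x j ^ 2 ∂ν ≤ d * kappaX ν := by
  rw [← sum_sqrt_fourth_moment_eq hd]
  exact Finset.sum_le_sum fun j _ => integral_sq_coord_le h4 j

lemma sum_sum_integral_sq_mul_sq_le (hd : 0 < d)
    (h4 : ∀ j, MemLp (fun x : EuclideanSpace ℝ (Fin d) => x j) 4 ν) :
    ∑ j, ∑ k, ∫ x, x j ^ 2 * x k ^ 2 ∂ν ≤ (d * kappaX ν) ^ 2 := by
  rw [← sum_sqrt_fourth_moment_eq hd, sq, Finset.sum_mul_sum]
  exact Finset.sum_le_sum fun j _ => Finset.sum_le_sum fun k _ => integral_sq_mul_sq_le h4 j k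

lemma covarianceMat_apply
    (h0 : ∀ j : Fin d, ∫ x, x j ∂ν = 0) (j k : Fin d) :
    covarianceMat ν j k = ∫ x, x j * x k ∂ν := by
  simp [covarianceMat, covariance, h0]

/-- The bilinear form of the covariance matrix. -/
noncomputable def covForm {d : ℕ} (ν : Measure (EuclideanSpace ℝ (Fin d))) (w w' : EuclideanSpace ℝ (Fin d)) :
    ℝ := WithLp.ofLp w ⬝ᵥ (covarianceMat ν *ᵥ WithLp.ofLp w')

lemma covForm_eq_sum (w w' : EuclideanSpace ℝ (Fin d)) :
    covForm ν w w' = ∑ j, ∑ k, w j * w' k * covarianceMat ν j k := by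
  simp only [covForm, dotProduct, mulVec, Finset.mul_sum]
  exact Finset.sum_congr rfl fun j _ => Finset.sum_congr rfl fun k _ => by ring

lemma inner_mul_inner_eq_sum (x w w' : EuclideanSpace ℝ (Fin d)) :
    inner ℝ x w * inner ℝ x w' = ∑ j, ∑ k, w j * w' k * (x j * x k) := by
  simp only [PiLp.inner_apply, RCLike.inner_apply, conj_trivial, Finset.sum_mul_sum]
  exact Finset.sum_congr rfl fun j _ => Finset.sum_congr rfl fun k _ => by ring

lemma integral_inner_sq [IsProbabilityMeasure ν] (h4 : ∀ j, MemLp (fun x : EuclideanSpace ℝ (Fin d) => x j) 4 ν)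
    (h0 : ∀ j : Fin d, ∫ x, x j ∂ν = 0) (w : EuclideanSpace ℝ (Fin d)) :
    ∫ x, inner ℝ x w ^ 2 ∂ν = covForm ν w w := by
  have hi : ∀ j k, Integrable (fun x : EuclideanSpace ℝ (Fin d) => w j * w k * (x j * x k)) ν :=
    fun j k => ((memLp_mul_coord h4 j k).integrable (by norm_num)).const_mul _
  simp only [sq, inner_mul_inner_eq_sum, covForm_eq_sum]
  rw [integral_finsetSum _ fun j _ => integrable_finsetSum _ fun k _ => hi j k]
  refine Finset.sum_congr rfl fun j _ => ?_
  rw [integral_finsetSum _ fun k _ => hi j k]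
  refine Finset.sum_congr rfl fun k _ => ?_
  rw [integral_const_mul, covarianceMat_apply h0]

/-- Cauchy–Schwarz over index pairs; it turns the Frobenius bound on the Gram error into a bound on
bilinear forms. -/
lemma abs_sum_sum_mul_le (M : Fin d → Fin d → ℝ) (w w' : EuclideanSpace ℝ (Fin d)) :
    |∑ j, ∑ k, w j * w' k * M j k| ≤ √(∑ p : Fin d × Fin d, M p.1 p.2 ^ 2) * ‖w‖ * ‖w'‖ := by
  rw [← Fintype.sum_prod_type' (f := fun j k => w j * w' k * M j k)]
  have h1 : ∑ p : Fin d × Fin d, (w p.1 * w' p.2) ^ 2 = (‖w‖ * ‖w'‖) ^ 2 := by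
    rw [mul_pow, EuclideanSpace.real_norm_sq_eq, EuclideanSpace.real_norm_sq_eq,
      Finset.sum_mul_sum, Fintype.sum_prod_type]
    simp only [mul_pow]
  refine (Real.abs_le_sqrt (Finset.sum_mul_sq_le_sq_mul_sq Finset.univ
    (fun p : Fin d × Fin d => w p.1 * w' p.2) (fun p => M p.1 p.2))).trans_eq ?_
  rw [h1, Real.sqrt_mul (sq_nonneg _), Real.sqrt_sq (by positivity)]
  ring

lemma memLp_inner (h4 : ∀ j, MemLp (fun x : EuclideanSpace ℝ (Fin d) => x j) 4 ν)
    (a : EuclideanSpace ℝ (Fin d)) :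
    MemLp (fun x : EuclideanSpace ℝ (Fin d) => inner ℝ x a) 4 ν := by
  simp only [PiLp.inner_apply, RCLike.inner_apply, conj_trivial]
  exact memLp_finsetSum _ fun j _ => (h4 j).const_mul _

/-- Cauchy–Schwarz reduces to `E ‖x‖⁴`. The resulting factor `d²` is crude but affordable, since the
Lindeberg term only needs `d³ / n → 0`. -/
lemma integral_inner_pow_four_le (hd : 0 < d)
    (h4 : ∀ j, MemLp (fun x : EuclideanSpace ℝ (Fin d) => x j) 4 ν)
    (a : EuclideanSpace ℝ (Fin d)) :
    Integrable (fun x : EuclideanSpace ℝ (Fin d) => inner ℝ x a ^ 4) ν ∧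
    ∫ x, inner ℝ x a ^ 4 ∂ν ≤ ‖a‖ ^ 4 * (d * kappaX ν) ^ 2 := by
  have hi : ∀ j k, Integrable (fun x : EuclideanSpace ℝ (Fin d) => x j ^ 2 * x k ^ 2) ν :=
    fun j k => (memLp_sq_coord h4 j).integrable_mul (memLp_sq_coord h4 k)
  have hsum : Integrable (fun x : EuclideanSpace ℝ (Fin d) =>
      ‖a‖ ^ 4 * ∑ j, ∑ k, x j ^ 2 * x k ^ 2) ν :=
    (integrable_finsetSum _ fun j _ => integrable_finsetSum _ fun k _ => hi j k).const_mul _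
  have hle : ∀ x : EuclideanSpace ℝ (Fin d),
      inner ℝ x a ^ 4 ≤ ‖a‖ ^ 4 * ∑ j, ∑ k, x j ^ 2 * x k ^ 2 := fun x => by
    have h1 : ∑ j, ∑ k, x j ^ 2 * x k ^ 2 = ‖x‖ ^ 4 := by
      rw [← Finset.sum_mul_sum, ← EuclideanSpace.real_norm_sq_eq]; ring
    have h2 := pow_le_pow_left₀ (abs_nonneg _) (abs_real_inner_le_norm x a) 4
    rw [h1, ← mul_pow, mul_comm ‖a‖]
    rwa [Even.pow_abs (by decide)] at h2
  have hint : Integrable (fun x : EuclideanSpace ℝ (Fin d) => inner ℝ x a ^ 4) ν := by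
    refine hsum.mono' (by fun_prop) (Eventually.of_forall fun x => ?_)
    rw [Real.norm_eq_abs, abs_of_nonneg (by positivity)]
    exact hle x
  refine ⟨hint, ?_⟩
  calc _ ≤ ∫ x, ‖a‖ ^ 4 * ∑ j, ∑ k, x j ^ 2 * x k ^ 2 ∂ν := integral_mono hint hsum hle
    _ = ‖a‖ ^ 4 * ∑ j, ∑ k, ∫ x, x j ^ 2 * x k ^ 2 ∂ν := by
      rw [integral_const_mul,
        integral_finsetSum _ fun j _ => integrable_finsetSum _ fun k _ => hi j k]
      congr 1
      exact Finset.sum_congr rfl fun j _ => integral_finsetSum _ fun k _ => hi j k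
    _ ≤ _ := mul_le_mul_of_nonneg_left (sum_sum_integral_sq_mul_sq_le hd h4) (by positivity)

/-- The Lindeberg term of a product of an error and a linear functional of the covariates. -/
lemma integral_prod_sq_mul_min_le [IsProbabilityMeasure ν] {Q : Measure ℝ} [IsProbabilityMeasure Q] (hQ : MemLp id 2 Q)
    (hd : 0 < d) (h4 : ∀ j, MemLp (fun x : EuclideanSpace ℝ (Fin d) => x j) 4 ν)
    (h0 : ∀ j : Fin d, ∫ x, x j ∂ν = 0) (a : EuclideanSpace ℝ (Fin d)) (s : ℝ) :
    ∫ z, (z.2 * inner ℝ z.1 a) ^ 2 * min 1 |s * (z.2 * inner ℝ z.1 a)| ∂(ν.prod Q) ≤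
      covForm ν a a * ∫ e, e ^ 2 * min 1 (e ^ 2 / d) ∂Q +
        ‖a‖ ^ 4 * (d * kappaX ν) ^ 2 * (s ^ 2 * d) * ∫ e, e ^ 2 ∂Q := by
  have hd' : (0 : ℝ) < d := by exact_mod_cast hd
  have hz2 : Integrable (fun x : EuclideanSpace ℝ (Fin d) => inner ℝ x a ^ 2) ν :=
    ((memLp_inner h4 a).mono_exponent (by norm_num)).integrable_sq
  obtain ⟨hz4, hz4le⟩ := integral_inner_pow_four_le hd h4 a
  have he2 : Integrable (fun e : ℝ => e ^ 2) Q := hQ.integrable_sq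
  have hem : Integrable (fun e : ℝ => e ^ 2 * min 1 (e ^ 2 / d)) Q := by
    refine he2.mono' (by fun_prop) (Eventually.of_forall fun e => ?_)
    rw [Real.norm_eq_abs, abs_of_nonneg (by positivity)]
    exact mul_le_of_le_one_right (sq_nonneg _) (min_le_left _ _)
  have hI1 := hz2.mul_prod hem
  have hI2 := (hz4.mul_prod he2).const_mul (s ^ 2 * d)
  calc _ ≤ ∫ z, (inner ℝ z.1 a ^ 2 * (z.2 ^ 2 * min 1 (z.2 ^ 2 / d)) +
        s ^ 2 * d * (inner ℝ z.1 a ^ 4 * z.2 ^ 2)) ∂(ν.prod Q) := by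
        refine integral_mono_of_nonneg (Eventually.of_forall fun z => by positivity)
          (hI1.add hI2) (Eventually.of_forall fun z => ?_)
        set e := z.2
        set y : ℝ := inner ℝ z.1 a
        -- An AM–GM split of `|s e y|` into `e² / d` and `s² d y²` separates error from covariate.
        -- The error part needs only a second moment and `d → ∞`; the covariate part uses fourth
        -- moments.
        have h1 : min 1 |s * (e * y)| ≤ min 1 (e ^ 2 / d) + s ^ 2 * d * y ^ 2 := by
          have hB : 0 ≤ s ^ 2 * d * y ^ 2 := by positivity
          rcases le_total 1 (e ^ 2 / d) with h | h
          · rw [min_eq_left h]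
            exact (min_le_left _ _).trans (by linarith)
          · rw [min_eq_right h]
            refine (min_le_right _ _).trans (abs_le_of_sq_le_sq ?_ (by positivity))
            have hA : 0 ≤ e ^ 2 / d := by positivity
            have : (s * (e * y)) ^ 2 = e ^ 2 / d * (s ^ 2 * d * y ^ 2) := by field_simp
            rw [this]
            nlinarith
        calc (e * y) ^ 2 * min 1 |s * (e * y)|
            ≤ (e * y) ^ 2 * (min 1 (e ^ 2 / d) + s ^ 2 * d * y ^ 2) :=
              mul_le_mul_of_nonneg_left h1 (sq_nonneg _)
          _ = _ := by ring
    _ = covForm ν a a * ∫ e, e ^ 2 * min 1 (e ^ 2 / d) ∂Q +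
        s ^ 2 * d * ((∫ x, inner ℝ x a ^ 4 ∂ν) * ∫ e, e ^ 2 ∂Q) := by
        rw [integral_add hI1 hI2, integral_const_mul,
          integral_prod_mul (fun x : EuclideanSpace ℝ (Fin d) => inner ℝ x a ^ 2)
            (fun e : ℝ => e ^ 2 * min 1 (e ^ 2 / d)),
          integral_prod_mul (fun x : EuclideanSpace ℝ (Fin d) => inner ℝ x a ^ 4)
            (fun e : ℝ => e ^ 2), integral_inner_sq h4 h0]
    _ ≤ _ := by
        have h1 : 0 ≤ ∫ e, e ^ 2 ∂Q := integral_nonneg fun e => sq_nonneg e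
        have h2 := mul_le_mul_of_nonneg_left hz4le (mul_nonneg (by positivity : 0 ≤ s ^ 2 * d) h1)
        linarith

end Moments

lemma tendsto_integral_sq_mul_min {Q : Measure ℝ} [IsProbabilityMeasure Q] (hQ : MemLp id 2 Q)
    {d : ℕ → ℕ} (hd : Tendsto d atTop atTop) :
    Tendsto (fun n => ∫ e, e ^ 2 * min 1 (e ^ 2 / d n) ∂Q) atTop (𝓝 0) := by
  have h := tendsto_integral_filter_of_dominated_convergence (μ := Q) (l := atTop)
    (F := fun n (e : ℝ) => e ^ 2 * min 1 (e ^ 2 / (d n : ℝ))) (f := fun _ => 0)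
    (fun e => e ^ 2) (Eventually.of_forall fun n => by fun_prop)
    (Eventually.of_forall fun n => Eventually.of_forall fun e => ?_) hQ.integrable_sq
    (Eventually.of_forall fun e => ?_)
  · simpa using h
  · rw [Real.norm_eq_abs, abs_of_nonneg (by positivity)]
    exact mul_le_of_le_one_right (sq_nonneg _) (min_le_left _ _)
  · have h1 : Tendsto (fun n => e ^ 2 / (d n : ℝ)) atTop (𝓝 0) :=
      tendsto_const_nhds.div_atTop (tendsto_natCast_atTop_atTop.comp hd)
    have h2 := ((tendsto_const_nhds (x := (1 : ℝ))).min h1).const_mul (e ^ 2)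
    simpa using h2

/-! ### Tail bounds for the score and the Gram matrix -/

section Tails

variable {Ω : Type*} [MeasurableSpace Ω] {P : Measure Ω} [IsProbabilityMeasure P] {n d : ℕ}
  {ν : Measure (EuclideanSpace ℝ (Fin d))} {Q : Measure ℝ}
  {X : Fin n → Ω → EuclideanSpace ℝ (Fin d)} {ε : Fin n → Ω → ℝ}

lemma memLp_snd_mul_prod [IsProbabilityMeasure Q] {E : Type*} [MeasurableSpace E] {μ : Measure E} [IsProbabilityMeasure μ]
    {g : E → ℝ} (hg : MemLp g 2 μ) (hQ : MemLp id 2 Q) :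
    MemLp (fun z : E × ℝ => z.2 * g z.1) 2 (μ.prod Q) := by
  have hm : AEStronglyMeasurable (fun z : E × ℝ => z.2 * g z.1) (μ.prod Q) :=
    (measurable_snd.aestronglyMeasurable).mul hg.aestronglyMeasurable.comp_fst
  rw [memLp_two_iff_integrable_sq hm]
  refine (hg.integrable_sq.mul_prod hQ.integrable_sq).congr (Eventually.of_forall fun z => ?_)
  simp [mul_pow, mul_comm]

lemma integral_snd_mul_prod [IsProbabilityMeasure Q] {E : Type*} [MeasurableSpace E] {μ : Measure E}
    [IsProbabilityMeasure μ] (g : E → ℝ) (hQ0 : ∫ x, x ∂Q = 0) :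
    ∫ z : E × ℝ, z.2 * g z.1 ∂(μ.prod Q) = 0 := by
  have := integral_prod_mul (μ := μ) (ν := Q) g (fun e : ℝ => e)
  rw [hQ0, mul_zero] at this
  rw [← this]
  exact integral_congr_ae (Eventually.of_forall fun z => mul_comm _ _)

lemma integral_snd_mul_prod_sq [IsProbabilityMeasure Q] {E : Type*} [MeasurableSpace E] {μ : Measure E}
    [IsProbabilityMeasure μ] (g : E → ℝ) :
    ∫ z : E × ℝ, (z.2 * g z.1) ^ 2 ∂(μ.prod Q) = (∫ x, g x ^ 2 ∂μ) * ∫ e, e ^ 2 ∂Q := by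
  rw [← integral_prod_mul (μ := μ) (ν := Q) (fun x => g x ^ 2) (fun e : ℝ => e ^ 2)]
  exact integral_congr_ae (Eventually.of_forall fun z => by ring)

lemma measure_lt_norm_score_le [IsProbabilityMeasure ν] [IsProbabilityMeasure Q]
    (hn : 0 < n) (hd : 0 < d)
    (hX : ∀ i, HasLaw (X i) ν P) (hXi : iIndepFun X P)
    (h4 : ∀ j, MemLp (fun x : EuclideanSpace ℝ (Fin d) => x j) 4 ν)
    (hε : ∀ i, HasLaw (ε i) Q P) (hεi : iIndepFun ε P)
    (hQ : MemLp id 2 Q) (hQ0 : ∫ x, x ∂Q = 0)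
    (hXε : IndepFun (fun ω i => X i ω) (fun ω i => ε i ω) P) {r : ℝ} (hr : 0 < r) :
    P {ω | √n * r < ‖∑ i, ε i ω • X i ω‖} ≤
      ENNReal.ofReal (d * kappaX ν * (∫ e, e ^ 2 ∂Q) / r ^ 2) := by
  have hn' : (0 : ℝ) < n := by exact_mod_cast hn
  have h := measure_lt_sum_sq_sum_le (hasLaw_prodMk_of_pi hX hε hXi hεi hXε)
    (iIndepFun_prodMk hX hε hXi hεi hXε)
    (f := fun (j : Fin d) (z : EuclideanSpace ℝ (Fin d) × ℝ) => z.2 * z.1 j)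
    (fun j => by fun_prop)
    (fun j => memLp_snd_mul_prod ((h4 j).mono_exponent (by norm_num)) hQ)
    (fun j => integral_snd_mul_prod (fun x : EuclideanSpace ℝ (Fin d) => x j) hQ0) (r := n * r ^ 2) (by positivity)
  refine (measure_mono fun ω hω => ?_).trans (h.trans (ENNReal.ofReal_le_ofReal ?_))
  · have h1 : √n * r < ‖∑ i, ε i ω • X i ω‖ := hω
    have h2 := pow_lt_pow_left₀ h1 (by positivity) (two_ne_zero)
    rw [mul_pow, Real.sq_sqrt hn'.le, EuclideanSpace.real_norm_sq_eq] at h2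
    simpa using h2
  · have h1 : ∀ j, ∫ z : EuclideanSpace ℝ (Fin d) × ℝ, (z.2 * z.1 j) ^ 2 ∂(ν.prod Q) =
        (∫ x, x j ^ 2 ∂ν) * ∫ e, e ^ 2 ∂Q :=
      fun j => integral_snd_mul_prod_sq (fun x : EuclideanSpace ℝ (Fin d) => x j)
    simp only [h1, ← Finset.sum_mul, Fintype.card_fin]
    rw [mul_div_mul_left _ _ hn'.ne']
    gcongr
    exact sum_integral_sq_coord_le hd h4

lemma measure_lt_gram_error_le [IsProbabilityMeasure ν] (hn : 0 < n) (hd : 0 < d)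
    (hX : ∀ i, HasLaw (X i) ν P) (hXi : iIndepFun X P)
    (h4 : ∀ j, MemLp (fun x : EuclideanSpace ℝ (Fin d) => x j) 4 ν)
    (h0 : ∀ j : Fin d, ∫ x, x j ∂ν = 0) {r : ℝ} (hr : 0 < r) :
    P {ω | r < √(∑ p : Fin d × Fin d,
      ((n : ℝ)⁻¹ * ∑ i, X i ω p.1 * X i ω p.2 - covarianceMat ν p.1 p.2) ^ 2)} ≤
      ENNReal.ofReal ((d * kappaX ν) ^ 2 / (n * r ^ 2)) := by
  have hn' : (0 : ℝ) < n := by exact_mod_cast hn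
  have hL := memLp_mul_coord h4
  have h := measure_lt_sum_sq_sum_le hX hXi
    (f := fun (p : Fin d × Fin d) (x : EuclideanSpace ℝ (Fin d)) =>
      x p.1 * x p.2 - covarianceMat ν p.1 p.2)
    (fun p => by fun_prop) (fun p => (hL p.1 p.2).sub (memLp_const _))
    (fun p => by
      rw [integral_sub ((hL p.1 p.2).integrable (by norm_num)) (integrable_const _),
        covarianceMat_apply h0]
      simp) (r := n ^ 2 * r ^ 2) (by positivity)
  refine (measure_mono fun ω hω => ?_).trans (h.trans (ENNReal.ofReal_le_ofReal ?_))
  · have h1 : r < √_ := hω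
    rw [Real.lt_sqrt hr.le] at h1
    have h2 := mul_lt_mul_of_pos_left h1 (pow_pos hn' 2)
    refine lt_of_lt_of_eq h2 ?_
    rw [Finset.mul_sum]
    refine Finset.sum_congr rfl fun p _ => ?_
    rw [← mul_pow, Finset.sum_sub_distrib, mul_sub, mul_inv_cancel_left₀ hn'.ne']
    simp
  · have h1 : ∑ p : Fin d × Fin d, ∫ x, (x p.1 * x p.2 - covarianceMat ν p.1 p.2) ^ 2 ∂ν ≤
        (d * kappaX ν) ^ 2 := by
      refine le_trans ?_ (sum_sum_integral_sq_mul_sq_le hd h4)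
      rw [← Fintype.sum_prod_type' (f := fun j k => ∫ x, x j ^ 2 * x k ^ 2 ∂ν)]
      refine Finset.sum_le_sum fun p _ => ?_
      have h2 := variance_le_expectation_sq (hL p.1 p.2).aestronglyMeasurable
      rw [variance_eq_integral (hL p.1 p.2).aemeasurable, ← covarianceMat_apply h0] at h2
      simpa [mul_pow] using h2
    rw [Fintype.card_fin]
    calc _ ≤ n * (d * kappaX ν) ^ 2 / (n ^ 2 * r ^ 2) := by gcongr
      _ = _ := by field_simp

lemma abs_gram_sub_covForm_le (x : Fin n → EuclideanSpace ℝ (Fin d))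
    (w w' : EuclideanSpace ℝ (Fin d)) :
    |(n : ℝ)⁻¹ * ∑ i, inner ℝ (x i) w * inner ℝ (x i) w' - covForm ν w w'| ≤
      √(∑ p : Fin d × Fin d,
        ((n : ℝ)⁻¹ * ∑ i, x i p.1 * x i p.2 - covarianceMat ν p.1 p.2) ^ 2) * ‖w‖ * ‖w'‖ := by
  refine le_of_eq_of_le (congrArg _ ?_) (abs_sum_sum_mul_le
    (fun j k => (n : ℝ)⁻¹ * ∑ i, x i j * x i k - covarianceMat ν j k) w w')
  simp only [mul_sub, Finset.sum_sub_distrib, covForm_eq_sum, inner_mul_inner_eq_sum]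
  congr 1
  rw [Finset.sum_comm, Finset.mul_sum]
  refine Finset.sum_congr rfl fun j _ => ?_
  rw [Finset.sum_comm, Finset.mul_sum]
  refine Finset.sum_congr rfl fun k _ => ?_
  rw [← Finset.mul_sum]
  ring

end Tails

/-! ### Limit law of the score -/

/-- Central limit theorem for the score in a fixed (dimension dependent) direction. -/
lemma tendsto_charFun_score {Ω : ℕ → Type*} [∀ n, MeasurableSpace (Ω n)]
    (P : (n : ℕ) → Measure (Ω n)) [∀ n, IsProbabilityMeasure (P n)] (d : ℕ → ℕ)
    (ν : (n : ℕ) → Measure (EuclideanSpace ℝ (Fin (d n)))) [∀ n, IsProbabilityMeasure (ν n)]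
    (Q : Measure ℝ) [IsProbabilityMeasure Q]
    (X : (n : ℕ) → Fin n → Ω n → EuclideanSpace ℝ (Fin (d n)))
    (ε : (n : ℕ) → Fin n → Ω n → ℝ)
    (hX : ∀ n i, HasLaw (X n i) (ν n) (P n)) (hXi : ∀ n, iIndepFun (X n) (P n))
    (h4 : ∀ n j, MemLp (fun x : EuclideanSpace ℝ (Fin (d n)) => x j) 4 (ν n))
    (h0 : ∀ n (j : Fin (d n)), ∫ x, x j ∂(ν n) = 0)
    (hε : ∀ n i, HasLaw (ε n i) Q (P n)) (hεi : ∀ n, iIndepFun (ε n) (P n))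
    (hQ : MemLp id 2 Q) (hQ0 : ∫ x, x ∂Q = 0)
    (hXε : ∀ n, IndepFun (fun ω i => X n i ω) (fun ω i => ε n i ω) (P n))
    (hC : SeqBddAbove fun n => kappaX (ν n))
    (hd : Tendsto d atTop atTop) (hdn : Tendsto (fun n : ℕ => (d n : ℝ) ^ 3 / n) atTop (𝓝 0))
    (a : (n : ℕ) → EuclideanSpace ℝ (Fin (d n))) (ha : SeqBddAbove fun n => ‖a n‖) {v : ℝ}
    (hv : Tendsto (fun n => covForm (ν n) (a n) (a n)) atTop (𝓝 v)) :
    Tendsto (fun n : ℕ => ∫ ω, Complex.exp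
      (((√(n : ℝ))⁻¹ * ∑ i, ε n i ω * inner ℝ (X n i ω) (a n) : ℝ) * Complex.I) ∂(P n)) atTop
      (𝓝 (Complex.exp (-((∫ e, e ^ 2 ∂Q) * v : ℝ) / 2))) := by
  let g : (n : ℕ) → EuclideanSpace ℝ (Fin (d n)) × ℝ → ℝ := fun n z => z.2 * inner ℝ z.1 (a n)
  have hgm : ∀ n, Measurable (g n) := fun n => by fun_prop
  have hin2 : ∀ n, MemLp (fun x : EuclideanSpace ℝ (Fin (d n)) => inner ℝ x (a n)) 2 (ν n) :=
    fun n => (memLp_inner (h4 n) (a n)).mono_exponent (by norm_num)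
  -- The law of one summand: the characteristic function of the row sum is the `n`-th power of that
  -- of `ρ n`.
  let ρ : ℕ → Measure ℝ := fun n => ((ν n).prod Q).map (g n)
  have hρ : ∀ n, IsProbabilityMeasure (ρ n) := fun n =>
    Measure.isProbabilityMeasure_map (hgm n).aemeasurable
  have hmap : ∀ n (f : ℝ → ℝ), Measurable f → ∫ x, f x ∂(ρ n) = ∫ z, f (g n z) ∂((ν n).prod Q) :=
    fun n f hf => integral_map (hgm n).aemeasurable hf.aestronglyMeasurable
  have hmain := tendsto_charFun_inv_sqrt_pow (ρ := ρ) (v := (∫ e, e ^ 2 ∂Q) * v)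
    (fun n => (memLp_map_measure_iff (by fun_prop) (hgm n).aemeasurable).2
      (memLp_snd_mul_prod (hin2 n) hQ))
    (fun n => by
      rw [hmap n (fun x => x) measurable_id]
      exact integral_snd_mul_prod (fun x : EuclideanSpace ℝ (Fin (d n)) => inner ℝ x (a n)) hQ0) ?_ ?_
  · refine hmain.congr fun n => ?_
    have hlaw : ∀ i, HasLaw (fun ω => g n (X n i ω, ε n i ω)) (ρ n) (P n) := fun i =>
      HasLaw.fun_comp (Y := g n) ⟨(hgm n).aemeasurable, rfl⟩
        (hasLaw_prodMk_of_pi (hX n) (hε n) (hXi n) (hεi n) (hXε n) i)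
    have hind : iIndepFun (fun i ω => g n (X n i ω, ε n i ω)) (P n) :=
      (iIndepFun_prodMk (hX n) (hε n) (hXi n) (hεi n) (hXε n)).comp (fun _ => g n) fun _ => hgm n
    have h1 := congrFun (hind.charFun_map_fun_sum_eq_prod fun i => (hlaw i).aemeasurable)
      (√(n : ℝ))⁻¹
    simp only [Finset.prod_apply, (hlaw _).map_eq, Finset.prod_const, Finset.card_univ,
      Fintype.card_fin] at h1
    rw [← h1, charFun_apply_real, integral_map
      (Finset.aemeasurable_fun_sum _ fun i _ => (hlaw i).aemeasurable) (by fun_prop)]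
    simp [g]
  · refine (hv.const_mul (∫ e, e ^ 2 ∂Q)).congr fun n => ?_
    rw [hmap n (fun x => x ^ 2) (by fun_prop), mul_comm, ← integral_inner_sq (h4 n) (h0 n)]
    exact (integral_snd_mul_prod_sq
      (fun x : EuclideanSpace ℝ (Fin (d n)) => inner ℝ x (a n))).symm
  · obtain ⟨K, hK⟩ := hC
    obtain ⟨L, hL⟩ := ha
    have hbound : ∀ᶠ n : ℕ in atTop, ∫ x, x ^ 2 * min 1 |(√(n : ℝ))⁻¹ * x| ∂(ρ n) ≤
        covForm (ν n) (a n) (a n) * ∫ e, e ^ 2 * min 1 (e ^ 2 / d n) ∂Q +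
        L ^ 4 * K ^ 2 * ((d n : ℝ) ^ 3 / n) * ∫ e, e ^ 2 ∂Q := by
      filter_upwards [hK, hL, hd.eventually_gt_atTop 0, eventually_gt_atTop 0] with n h1 h2 h3 h4'
      have hn' : (0 : ℝ) < n := by exact_mod_cast h4'
      rw [hmap n (fun x => x ^ 2 * min 1 |(√(n : ℝ))⁻¹ * x|) (by fun_prop)]
      refine (integral_prod_sq_mul_min_le hQ h3 (h4 n) (h0 n) (a n) _).trans ?_
      have hk0 : 0 ≤ kappaX (ν n) := by
        unfold kappaX; positivity
      have h5 : 0 ≤ ∫ e, e ^ 2 ∂Q := integral_nonneg fun e => sq_nonneg e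
      have h6 : ‖a n‖ ^ 4 * (d n * kappaX (ν n)) ^ 2 * ((√(n : ℝ))⁻¹ ^ 2 * d n) =
          ‖a n‖ ^ 4 * kappaX (ν n) ^ 2 * ((d n : ℝ) ^ 3 / n) := by
        rw [inv_pow, Real.sq_sqrt hn'.le]; field_simp
      rw [h6]
      gcongr
    refine squeeze_zero' (Eventually.of_forall fun n => integral_nonneg fun x => by positivity)
      hbound ?_
    have h1 := (hv.mul (tendsto_integral_sq_mul_min hQ hd)).add
      ((hdn.const_mul (L ^ 4 * K ^ 2)).mul_const (∫ e, e ^ 2 ∂Q))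
    simpa using h1

/-! ### The covariance form and its dual vectors -/

/-- Subtracting `c` times the identity shifts the spectrum by `c`, so `M - c` has nonnegative
spectrum and is positive semidefinite. -/
lemma minEigenvalue_mul_dotProduct_le {d : ℕ} {M : Matrix (Fin d) (Fin d) ℝ} (hM : M.IsHermitian)
    {c : ℝ} (hc : c ≤ minEigenvalue M) (x : Fin d → ℝ) : c * (x ⬝ᵥ x) ≤ x ⬝ᵥ (M *ᵥ x) := by
  have hH : (M - algebraMap ℝ _ c).IsHermitian := by
    refine hM.sub ?_
    rw [Matrix.algebraMap_eq_diagonal]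
    exact isHermitian_diagonal _
  have h : (M - algebraMap ℝ _ c).PosSemidef := by
    refine posSemidef_iff_isHermitian_and_spectrum_nonneg.2 ⟨hH, fun y hy => ?_⟩
    rw [← spectrum.sub_singleton_eq] at hy
    obtain ⟨z, hz, w, hw, rfl⟩ := hy
    rw [Set.mem_singleton_iff] at hw
    subst hw
    exact sub_nonneg.2 (hc.trans (csInf_le M.finite_real_spectrum.bddBelow hz))
  have h1 := h.dotProduct_mulVec_nonneg x
  rw [sub_mulVec, dotProduct_sub, Algebra.algebraMap_eq_smul_one, smul_mulVec, one_mulVec,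
    dotProduct_smul] at h1
  simpa using h1

section CovForm

variable {d : ℕ} {ν : Measure (EuclideanSpace ℝ (Fin d))}

lemma covarianceMat_isHermitian : (covarianceMat ν).IsHermitian := by
  ext j k
  simp [covarianceMat, covariance_comm]

lemma mul_norm_sq_le_covForm {c : ℝ} (hc : c ≤ minEigenvalue (covarianceMat ν))
    (w : EuclideanSpace ℝ (Fin d)) : c * ‖w‖ ^ 2 ≤ covForm ν w w := by
  have := minEigenvalue_mul_dotProduct_le covarianceMat_isHermitian hc (WithLp.ofLp w)
  rw [EuclideanSpace.real_norm_sq_eq]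
  simpa [covForm, dotProduct, sq] using this

/-- The Riesz representative, for the covariance form, of the functional with coefficients `b`. -/
noncomputable def covDual (ν : Measure (EuclideanSpace ℝ (Fin d))) (b : Fin d → ℝ) :
    EuclideanSpace ℝ (Fin d) :=
  WithLp.toLp 2 ((covarianceMat ν)⁻¹ *ᵥ b)

lemma covForm_covDual {c : ℝ} (hc0 : 0 < c) (hc : c ≤ minEigenvalue (covarianceMat ν))
    (b : Fin d → ℝ) (w : EuclideanSpace ℝ (Fin d)) :
    covForm ν (covDual ν b) w = b ⬝ᵥ WithLp.ofLp w := by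
  -- Coercivity excludes a kernel, so `⁻¹` is the true inverse and not the default value of a
  -- singular matrix.
  have hdet : (covarianceMat ν).det ≠ 0 := by
    rw [Ne, ← exists_mulVec_eq_zero_iff]
    rintro ⟨v, hv, hv0⟩
    have h1 := minEigenvalue_mul_dotProduct_le covarianceMat_isHermitian hc v
    rw [hv0, dotProduct_zero] at h1
    have h2 : 0 < v ⬝ᵥ v := by
      simpa using dotProduct_star_self_pos_iff.2 hv
    nlinarith
  have hT : (covarianceMat ν)ᵀ = covarianceMat ν := by
    simpa [IsSymm] using covarianceMat_isHermitian (ν := ν)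
  rw [covForm, covDual, dotProduct_mulVec, ← mulVec_transpose, hT, mulVec_mulVec,
    mul_nonsing_inv _ hdet.isUnit, one_mulVec]

lemma norm_covDual_le {c : ℝ} (hc0 : 0 < c) (hc : c ≤ minEigenvalue (covarianceMat ν))
    (b : Fin d → ℝ) : ‖covDual ν b‖ ≤ ‖WithLp.toLp 2 b‖ / c := by
  have h1 := mul_norm_sq_le_covForm hc (covDual ν b)
  rw [covForm_covDual hc0 hc] at h1
  have h2 : b ⬝ᵥ WithLp.ofLp (covDual ν b) ≤ ‖WithLp.toLp 2 b‖ * ‖covDual ν b‖ := by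
    refine le_of_eq_of_le ?_ (real_inner_le_norm (WithLp.toLp 2 b) (covDual ν b))
    simp [PiLp.inner_apply, dotProduct, mul_comm]
  rw [le_div_iff₀ hc0]
  rcases eq_or_lt_of_le (norm_nonneg (covDual ν b)) with h | h
  · rw [← h, zero_mul]; exact norm_nonneg _
  · refine le_of_mul_le_mul_right ?_ h
    nlinarith

end CovForm

lemma norm_mulVec_transpose_le {q d : ℕ} (A : Matrix (Fin q) (Fin d) ℝ)
    (t : EuclideanSpace ℝ (Fin q)) :
    ‖(WithLp.toLp 2 (Aᵀ *ᵥ WithLp.ofLp t) : EuclideanSpace ℝ (Fin d))‖ ≤ frobNorm A * ‖t‖ := by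
  have h0 : 0 ≤ ∑ i, ∑ j, A i j ^ 2 :=
    Finset.sum_nonneg fun i _ => Finset.sum_nonneg fun j _ => sq_nonneg _
  have h1 := Real.sqrt_mul h0 (∑ i, ‖t i‖ ^ 2)
  rw [EuclideanSpace.norm_eq, EuclideanSpace.norm_eq, frobNorm]
  refine le_of_le_of_eq (Real.sqrt_le_sqrt ?_) h1
  rw [Finset.sum_comm, Finset.sum_mul]
  refine Finset.sum_le_sum fun j _ => ?_
  simpa [mulVec, dotProduct] using
    Finset.sum_mul_sq_le_sq_mul_sq Finset.univ (fun i => A i j) (fun i => t i)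

lemma abs_le_frobNorm {m k : ℕ} (M : Matrix (Fin m) (Fin k) ℝ) (i : Fin m) (j : Fin k) :
    |M i j| ≤ frobNorm M := by
  refine Real.abs_le_sqrt ?_
  calc M i j ^ 2 ≤ ∑ j, M i j ^ 2 :=
        Finset.single_le_sum (f := fun j => M i j ^ 2) (fun _ _ => sq_nonneg _)
          (Finset.mem_univ j)
    _ ≤ _ := Finset.single_le_sum (f := fun i => ∑ j, M i j ^ 2)
          (fun _ _ => Finset.sum_nonneg fun _ _ => sq_nonneg _) (Finset.mem_univ i)

lemma tendsto_dotProduct_mulVec_of_frobNorm {q : ℕ} {M : ℕ → Matrix (Fin q) (Fin q) ℝ}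
    {G : Matrix (Fin q) (Fin q) ℝ} (h : Tendsto (fun n => frobNorm (M n - G)) atTop (𝓝 0))
    (t : Fin q → ℝ) :
    Tendsto (fun n => t ⬝ᵥ (M n *ᵥ t)) atTop (𝓝 (t ⬝ᵥ (G *ᵥ t))) := by
  have h1 : ∀ i j, Tendsto (fun n => M n i j) atTop (𝓝 (G i j)) := fun i j => by
    rw [tendsto_iff_norm_sub_tendsto_zero]
    exact squeeze_zero (fun _ => norm_nonneg _) (fun n => abs_le_frobNorm (M n - G) i j) h
  simp only [dotProduct, mulVec]
  exact tendsto_finsetSum _ fun i _ => (tendsto_finsetSum _ fun j _ =>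
    (h1 i j).mul_const _).const_mul _

/-! ### Comparison of characteristic functions and rates -/

/-- Real random variables that are close outside a small set have close characteristic functions. -/
lemma norm_integral_cexp_sub_le {Ω : Type*} [MeasurableSpace Ω] {P : Measure Ω}
    [IsProbabilityMeasure P] {W U : Ω → ℝ} (hW : AEMeasurable W P) (hU : AEMeasurable U P)
    {S : Set Ω} {η : ℝ} (hη : 0 ≤ η) (h : ∀ ω ∉ S, |W ω - U ω| ≤ η) :
    ‖∫ ω, Complex.exp (W ω * Complex.I) ∂P - ∫ ω, Complex.exp (U ω * Complex.I) ∂P‖ ≤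
      η + 2 * P.real S := by
  have hint : ∀ {V : Ω → ℝ}, AEMeasurable V P →
      Integrable (fun ω => Complex.exp (V ω * Complex.I)) P := fun {V} hV => by
    refine Integrable.of_bound (AEMeasurable.aestronglyMeasurable (by fun_prop)) 1
      (Eventually.of_forall fun x => ?_)
    rw [Complex.norm_exp_ofReal_mul_I]
  -- The exceptional set need not be measurable; its measurable hull has the same measure.
  have hS := measurableSet_toMeasurable P S
  rw [← integral_sub (hint hW) (hint hU)]
  calc _ ≤ ∫ ω, (η + (toMeasurable P S).indicator (fun _ => (2 : ℝ)) ω) ∂P := by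
        refine norm_integral_le_of_norm_le
          ((integrable_const _).add ((integrable_const _).indicator hS))
          (Eventually.of_forall fun ω => ?_)
        by_cases hω : ω ∈ toMeasurable P S
        · rw [Set.indicator_of_mem hω]
          refine (norm_sub_le _ _).trans ?_
          rw [Complex.norm_exp_ofReal_mul_I, Complex.norm_exp_ofReal_mul_I]
          linarith
        · rw [Set.indicator_of_notMem hω, add_zero]
          refine le_trans ?_ (h ω fun hS' => hω (subset_toMeasurable P S hS'))
          have h1 : Complex.exp (W ω * Complex.I) - Complex.exp (U ω * Complex.I) =
              Complex.exp (U ω * Complex.I) *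
                (Complex.exp (Complex.I * ((W ω - U ω : ℝ) : ℂ)) - 1) := by
            rw [mul_sub, ← Complex.exp_add]
            push_cast
            ring_nf
          rw [h1, norm_mul, Complex.norm_exp_ofReal_mul_I, one_mul]
          exact Real.norm_exp_I_mul_ofReal_sub_one_le
    _ = _ := by
        rw [integral_add (integrable_const _) ((integrable_const _).indicator hS),
          integral_indicator_const _ hS]
        simp [Measure.real, measure_toMeasurable, mul_comm]

lemma tendsto_pow_five_div_of_isLittleO {d : ℕ → ℕ} (hd : Tendsto d atTop atTop)
    (h : (fun n => (d n : ℝ) ^ 5 * Real.log (d n)) =o[atTop] fun n => (n : ℝ)) :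
    Tendsto (fun n : ℕ => (d n : ℝ) ^ 5 / n) atTop (𝓝 0) := by
  have hlog : Tendsto (fun n => Real.log (d n)) atTop atTop :=
    Real.tendsto_log_atTop.comp (tendsto_natCast_atTop_atTop.comp hd)
  refine squeeze_zero' (Eventually.of_forall fun n => by positivity) ?_ h.tendsto_div_nhds_zero
  filter_upwards [hlog.eventually_ge_atTop 1] with n hn
  gcongr
  exact le_mul_of_one_le_right (by positivity) hn

/-- The five exceptional events of the linearization have vanishing probability. -/
lemma tendsto_measure_union_five {Ω : ℕ → Type*} [∀ n, MeasurableSpace (Ω n)]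
    {P : (n : ℕ) → Measure (Ω n)} {S₁ S₂ S₃ S₄ S₅ : (n : ℕ) → Set (Ω n)}
    (h₁ : Tendsto (fun n => P n (S₁ n)) atTop (𝓝 0))
    (h₂ : Tendsto (fun n => P n (S₂ n)) atTop (𝓝 0))
    (h₃ : Tendsto (fun n => P n (S₃ n)) atTop (𝓝 0))
    (h₄ : Tendsto (fun n => P n (S₄ n)) atTop (𝓝 0))
    (h₅ : Tendsto (fun n => P n (S₅ n)) atTop (𝓝 0)) :
    Tendsto (fun n => (P n).real (S₁ n ∪ S₂ n ∪ S₃ n ∪ S₄ n ∪ S₅ n)) atTop (𝓝 0) := by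
  have h : Tendsto (fun n => P n (S₁ n ∪ S₂ n ∪ S₃ n ∪ S₄ n ∪ S₅ n)) atTop (𝓝 0) := by
    refine tendsto_of_tendsto_of_tendsto_of_le_of_le tendsto_const_nhds
      (by simpa using (((h₁.add h₂).add h₃).add h₄).add h₅) (fun _ => zero_le) fun n => ?_
    refine (measure_union_le _ _).trans (add_le_add_left ((measure_union_le _ _).trans
      (add_le_add_left ((measure_union_le _ _).trans
        (add_le_add_left (measure_union_le _ _) _)) _)) _)
  exact (ENNReal.tendsto_toReal ENNReal.zero_ne_top).comp h

/-- The deterministic rates in the linearization of the penalized least-squares estimate: the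
Gram matrix is close to the covariance matrix, the bias of the residuals stays below the
regularization parameter, and the error of the linearization vanishes. -/
lemma exists_linearization_rate {d s₁ s₂ : ℕ → ℕ} {κ γ lam : ℕ → ℝ} {α c : ℝ} (hc0 : 0 < c)
    (hκpos : ∀ n, 0 < κ n) (hγpos : ∀ n, 0 < γ n) (hlampos : ∀ n, 0 < lam n) (hα : 2 < α)
    (hlamκ : (fun n => √(d n : ℝ) * κ n) =o[atTop] lam) (hlamγ : ∀ n, α * γ n ≤ lam n)
    (hd1 : ∀ᶠ n in atTop, 1 ≤ d n)
    (hd3 : Tendsto (fun n : ℕ => (d n : ℝ) ^ 3 / n) atTop (𝓝 0))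
    (hd5 : Tendsto (fun n : ℕ => (d n : ℝ) ^ 5 / n) atTop (𝓝 0))
    (hs₁ : (fun n => (s₁ n : ℝ)) =o[atTop] fun n => √(n : ℝ) / (lam n * √(d n : ℝ) * κ n))
    (hs₂ : (fun n => (s₂ n : ℝ)) =o[atTop] fun n => √(n : ℝ) / (√(d n : ℝ) * κ n * γ n)) :
    ∃ η : ℕ → ℝ, Tendsto η atTop (𝓝 0) ∧ (∀ n, 0 ≤ η n) ∧
      (∀ᶠ n : ℕ in atTop, √((d n : ℝ) ^ 3 / n) + s₁ n * κ n ^ 2 / n ≤ c / 2) ∧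
      (∀ᶠ n : ℕ in atTop, 2 * γ n + κ n * (2 / c * (d n +
        (2 * s₁ n * lam n * κ n + s₂ n * γ n * κ n) / √n) / √n) < lam n) ∧
      ∀ᶠ n : ℕ in atTop, (2 * s₁ n * lam n * κ n + s₂ n * γ n * κ n) / √n +
        (√((d n : ℝ) ^ 3 / n) + s₁ n * κ n ^ 2 / n) *
          (2 / c * (d n + (2 * s₁ n * lam n * κ n + s₂ n * γ n * κ n) / √n)) ≤ η n := by
  let r₁ : ℕ → ℝ := fun n => s₁ n / (√(n : ℝ) / (lam n * √(d n : ℝ) * κ n))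
  let r₂ : ℕ → ℝ := fun n => s₂ n / (√(n : ℝ) / (√(d n : ℝ) * κ n * γ n))
  have hr₁ : Tendsto r₁ atTop (𝓝 0) := hs₁.tendsto_div_nhds_zero
  have hr₂ : Tendsto r₂ atTop (𝓝 0) := hs₂.tendsto_div_nhds_zero
  have hr₁0 : ∀ n, 0 ≤ r₁ n := fun n => by
    have := hlampos n; have := hκpos n; positivity
  have hr₂0 : ∀ n, 0 ≤ r₂ n := fun n => by
    have := hγpos n; have := hκpos n; positivity
  let ρ : ℕ → ℝ := fun n => (2 * s₁ n * lam n * κ n + s₂ n * γ n * κ n) / √n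
  have hρ0 : ∀ n, 0 ≤ ρ n := fun n => by
    have := hlampos n; have := hκpos n; have := hγpos n; positivity
  have hρle : ∀ᶠ n in atTop, ρ n ≤ 2 * r₁ n + r₂ n := by
    filter_upwards [hd1] with n h1
    have h2 : 1 ≤ √(d n : ℝ) := Real.one_le_sqrt.2 (by exact_mod_cast h1)
    have hl := hlampos n
    have hk := hκpos n
    have hg := hγpos n
    have h3 : 2 * r₁ n + r₂ n = (2 * s₁ n * lam n * κ n + s₂ n * γ n * κ n) * √(d n : ℝ) / √n := by
      simp only [r₁, r₂, div_div_eq_mul_div]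
      ring
    rw [h3]
    simp only [ρ]
    gcongr
    exact le_mul_of_one_le_right (by positivity) h2
  -- In `s₁ (√d κ)² / n`, one factor `√d κ` is replaced by `lam` and `n` by `√n`.
  have hsκ : ∀ᶠ n : ℕ in atTop, s₁ n * κ n ^ 2 / n * d n ≤ r₁ n := by
    filter_upwards [hlamκ.bound zero_lt_one, eventually_ge_atTop 1] with n h1 h2
    have hl := hlampos n
    have hk := hκpos n
    rw [one_mul, Real.norm_of_nonneg (by positivity), Real.norm_of_nonneg hl.le] at h1
    have hn1 : (1 : ℝ) ≤ n := by exact_mod_cast h2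
    have hn2 : √(n : ℝ) ≤ n := Real.sqrt_le_iff.2 ⟨by linarith, by nlinarith⟩
    have hn3 : 0 < √(n : ℝ) := Real.sqrt_pos.2 (by linarith)
    have h3 : s₁ n * κ n ^ 2 / n * d n = s₁ n * ((√(d n) * κ n) * (√(d n) * κ n)) / n := by
      have := Real.mul_self_sqrt (Nat.cast_nonneg (α := ℝ) (d n))
      linear_combination (-(s₁ n * κ n ^ 2 / n)) * this
    have h4 : r₁ n = s₁ n * (lam n * (√(d n) * κ n)) / √n := by
      simp only [r₁, div_div_eq_mul_div]
      ring
    rw [h3, h4]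
    gcongr
  let D : ℕ → ℝ := fun n => √((d n : ℝ) ^ 3 / n)
  have hD : Tendsto D atTop (𝓝 0) := by
    have := hd3.sqrt
    rwa [Real.sqrt_zero] at this
  have hDd : ∀ n, D n * d n = √((d n : ℝ) ^ 5 / n) := fun n => by
    rw [show (d n : ℝ) ^ 5 / n = (d n : ℝ) ^ 3 / n * (d n : ℝ) ^ 2 by ring,
      Real.sqrt_mul (by positivity), Real.sqrt_sq (by positivity)]
  have hDdlim : Tendsto (fun n => √((d n : ℝ) ^ 5 / n)) atTop (𝓝 0) := by
    have := hd5.sqrt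
    rwa [Real.sqrt_zero] at this
  have hsκ' : ∀ᶠ n : ℕ in atTop, s₁ n * κ n ^ 2 / n ≤ r₁ n := by
    filter_upwards [hsκ, hd1] with n h1 h2
    refine le_trans (le_mul_of_one_le_right (by positivity) ?_) h1
    exact_mod_cast h2
  have hDc : ∀ᶠ n : ℕ in atTop, D n + s₁ n * κ n ^ 2 / n ≤ c / 2 := by
    have h : Tendsto (fun n => D n + r₁ n) atTop (𝓝 0) := by simpa using hD.add hr₁
    filter_upwards [hsκ', h.eventually_le_const (half_pos hc0)] with n h1 h2
    linarith
  have hsmall : ∀ᶠ n : ℕ in atTop, 2 * γ n + κ n * (2 / c * (d n + ρ n) / √n) < lam n := by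
    have hα0 : 0 < α := by linarith
    -- As `α > 2`, the noise bound `2 γ ≤ (2 / α) lam` leaves a fixed fraction of `lam` free; the
    -- fit `κ R ≤ κ` is made to use at most half of it.
    have hθ : 0 < (1 - 2 / α) / 2 := by
      have : 2 / α < 1 := (div_lt_one hα0).2 hα
      linarith
    have hx : Tendsto (fun n => 2 / c * (D n + (2 * r₁ n + r₂ n))) atTop (𝓝 0) := by
      simpa using (hD.add ((hr₁.const_mul 2).add hr₂)).const_mul (2 / c)
    filter_upwards [hx.eventually_le_const zero_lt_one, hlamκ.bound hθ, hd1, hρle,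
      eventually_ge_atTop 1] with n h1 h2 h3 h4 h5
    have hl := hlampos n
    have hk := hκpos n
    have hd1' : (1 : ℝ) ≤ d n := by exact_mod_cast h3
    have hn1 : (1 : ℝ) ≤ n := by exact_mod_cast h5
    have hsn : 1 ≤ √(n : ℝ) := Real.one_le_sqrt.2 hn1
    rw [Real.norm_of_nonneg (by positivity), Real.norm_of_nonneg hl.le] at h2
    have hκ1 : κ n ≤ (1 - 2 / α) / 2 * lam n :=
      (le_mul_of_one_le_left hk.le (Real.one_le_sqrt.2 hd1')).trans h2
    have hdD : (d n : ℝ) / √n ≤ D n := by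
      refine (div_le_iff₀ (by linarith)).2 ?_
      rw [← Real.sqrt_mul (by positivity), div_mul_cancel₀ _ (by positivity)]
      refine Real.le_sqrt_of_sq_le ?_
      exact pow_le_pow_right₀ hd1' (by norm_num)
    have hx1 : 2 / c * (d n + ρ n) / √n ≤ 1 := by
      refine le_trans ?_ h1
      rw [mul_div_assoc, add_div]
      gcongr
      exact (div_le_self (hρ0 n) hsn).trans h4
    have h6 : 2 * γ n ≤ 2 / α * lam n := by
      have := hlamγ n
      rw [div_mul_eq_mul_div, le_div_iff₀ hα0]
      linarith
    have h7 : κ n * (2 / c * (d n + ρ n) / √n) ≤ κ n := mul_le_of_le_one_right hk.le hx1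
    nlinarith [mul_pos hθ hl]
  let η : ℕ → ℝ := fun n => (2 * r₁ n + r₂ n) + 2 / c *
    ((√((d n : ℝ) ^ 5 / n) + r₁ n) + (D n + r₁ n) * (2 * r₁ n + r₂ n))
  have hη : Tendsto η atTop (𝓝 0) := by
    have h1 : Tendsto (fun n => 2 * r₁ n + r₂ n) atTop (𝓝 0) := by
      simpa using (hr₁.const_mul 2).add hr₂
    have := h1.add (((hDdlim.add hr₁).add ((hD.add hr₁).mul h1)).const_mul (2 / c))
    simp only [add_zero, mul_zero] at this
    exact this
  have hηle : ∀ᶠ n in atTop, ρ n + (D n + s₁ n * κ n ^ 2 / n) * (2 / c * (d n + ρ n)) ≤ η n := by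
    filter_upwards [hρle, hsκ, hsκ'] with n h1 h2 h3
    have h4 := hDd n
    have h5 : (D n + s₁ n * κ n ^ 2 / n) * ρ n ≤ (D n + r₁ n) * (2 * r₁ n + r₂ n) := by
      have := hρ0 n; have := hr₁0 n
      have h6 : 0 ≤ D n := Real.sqrt_nonneg _
      gcongr
    have h6 : (D n + s₁ n * κ n ^ 2 / n) * (2 / c * (d n + ρ n)) =
        2 / c * ((D n * d n + s₁ n * κ n ^ 2 / n * d n) + (D n + s₁ n * κ n ^ 2 / n) * ρ n) := by
      ring
    rw [h6, h4]
    simp only [η]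
    gcongr
  refine ⟨η, hη, fun n => ?_, hDc, hsmall, hηle⟩
  have := hr₁0 n
  have := hr₂0 n
  have : 0 ≤ D n := Real.sqrt_nonneg _
  positivity

/-! ### Proof of the theorem -/

theorem theorem5p3
    -- one probability space per sample size
    {Ω : ℕ → Type*} [∀ n, MeasurableSpace (Ω n)]
    (P : (n : ℕ) → Measure (Ω n)) [∀ n, IsProbabilityMeasure (P n)]
    -- dimension, and numbers of large and of bounded incidental parameters
    (d s₁ s₂ : ℕ → ℕ)
    -- distributions of the covariates and of the errors
    (ν : (n : ℕ) → Measure (EuclideanSpace ℝ (Fin (d n)))) [∀ n, IsProbabilityMeasure (ν n)]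
    (Q : Measure ℝ) [IsProbabilityMeasure Q] (σ : ℝ)
    (X : (n : ℕ) → Fin n → Ω n → EuclideanSpace ℝ (Fin (d n)))
    (ε : (n : ℕ) → Fin n → Ω n → ℝ)
    (Y : (n : ℕ) → Fin n → Ω n → ℝ)
    (μs : (n : ℕ) → Fin n → ℝ)
    (βs : (n : ℕ) → EuclideanSpace ℝ (Fin (d n)))
    (κ γ lam : ℕ → ℝ) (α : ℝ)
    (q : ℕ) (A : (n : ℕ) → Matrix (Fin q) (Fin (d n)) ℝ) (GX : Matrix (Fin q) (Fin q) ℝ)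
    (βhat : (n : ℕ) → Ω n → EuclideanSpace ℝ (Fin (d n)))
    -- the linear model with incidental parameters
    (hY : ∀ n i ω, Y n i ω = μs n i + inner ℝ (X n i ω) (βs n) + ε n i ω)
    -- i.i.d. covariates: mean zero, finite fourth moments
    (hXlaw : ∀ n i, HasLaw (X n i) (ν n) (P n))
    (hXindep : ∀ n, iIndepFun (X n) (P n))
    (hXmom : ∀ n j, MemLp (fun x : EuclideanSpace ℝ (Fin (d n)) => x j) 4 (ν n))
    (hXmean : ∀ n (j : Fin (d n)), ∫ x, x j ∂(ν n) = 0)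
    -- i.i.d. errors: mean zero, variance `σ²`, independent of the covariates
    (hεlaw : ∀ n i, HasLaw (ε n i) Q (P n))
    (hεindep : ∀ n, iIndepFun (ε n) (P n))
    (hεmom : MemLp id 2 Q)
    (hεmean : ∫ x, x ∂Q = 0)
    (hεvar : Var[id; Q] = σ ^ 2)
    (hXε : ∀ n, IndepFun (fun ω i => X n i ω) (fun ω i => ε n i ω) (P n))
    -- the sequences `κₙ, γₙ ≪ √n`
    (hκpos : ∀ n, 0 < κ n) (hγpos : ∀ n, 0 < γ n)
    (hκ : κ =o[atTop] fun n => √(n : ℝ))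
    (hγ : γ =o[atTop] fun n => √(n : ℝ))
    (hXmax : Tendsto (fun n => P n {ω | ∃ i, κ n < ‖X n i ω‖}) atTop (𝓝 0))
    (hεmax : Tendsto (fun n => P n {ω | ∃ i, γ n < |ε n i ω|}) atTop (𝓝 0))
    -- sparsity: the incidental parameters numbered `s₁ + 1, …, s₁ + s₂` are bounded by `γₙ`,
    -- those after them vanish
    (hs₁n : (fun n => (s₁ n : ℝ)) =o[atTop] fun n => (n : ℝ))
    (hs₂n : (fun n => (s₂ n : ℝ)) =o[atTop] fun n => (n : ℝ))
    (hμbdd : ∀ n (i : Fin n), s₁ n ≤ i → (i : ℕ) < s₁ n + s₂ n → |μs n i| ≤ γ n)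
    (hμzero : ∀ n (i : Fin n), s₁ n + s₂ n ≤ i → μs n i = 0)
    -- regularization parameter: `√d κₙ ≪ λ`, `α γₙ ≤ λ` with `α > 2`, and
    -- `λ ≪ min_{i ≤ s₁} |μᵢ*|` (the first `s₁` incidental parameters are large)
    (hlampos : ∀ n, 0 < lam n) (hα : 2 < α)
    (hlamκ : (fun n => √(d n : ℝ) * κ n) =o[atTop] lam)
    (hlamγ : ∀ n, α * γ n ≤ lam n)
    (hlamμ : ∀ M : ℝ, ∀ᶠ n in atTop, ∀ i : Fin n, (i : ℕ) < s₁ n → M * lam n ≤ |μs n i|)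
    -- (B1'), (B2), (C), (D), (E)
    (hB1' : SeqAwayFromZero fun n => minEigenvalue (covarianceMat (ν n)))
    (hB2 : SeqBddAbove fun n => frobNormScaled (covarianceMat (ν n)))
    (hC : SeqBddAbove fun n => kappaX (ν n))
    (hDA : SeqBddAbove fun n => frobNorm (A n))
    (hDG : SeqBddAbove fun n => maxEigenvalue (A n * (A n)ᵀ))
    (hDsymm : GX.IsSymm)
    (hDlim : Tendsto (fun n => frobNorm (A n * (covarianceMat (ν n))⁻¹ * (A n)ᵀ - GX))
      atTop (𝓝 0))
    (hEσmax : SeqBddAbove fun n => sigmaXMax (ν n))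
    (hEγ : SeqBddAbove fun n => gammaXMin (ν n))
    (hEσmin : SeqAwayFromZero fun n => sigmaXMin (ν n))
    -- growth of the dimension and of the numbers of nonzero incidental parameters
    (hd : Tendsto d atTop atTop)
    (hdn : (fun n => (d n : ℝ) ^ 5 * Real.log (d n)) =o[atTop] fun n => (n : ℝ))
    (hs₁ : (fun n => (s₁ n : ℝ)) =o[atTop] fun n => √(n : ℝ) / (lam n * √(d n : ℝ) * κ n))
    (hs₂ : (fun n => (s₂ n : ℝ)) =o[atTop] fun n => √(n : ℝ) / (√(d n : ℝ) * κ n * γ n))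
    -- with probability going to one, `βhat` is the penalized least-squares estimator
    (hβmeas : ∀ n, AEMeasurable (βhat n) (P n))
    (hβhat : Tendsto (fun n => P n {ω | ¬ IsPLSEstimate (fun i => X n i ω) (fun i => Y n i ω)
      (lam n) (βhat n ω)}) atTop (𝓝 0)) :
    TendstoInDistribution
      (fun (n : ℕ) ω => (WithLp.toLp 2 (√(n : ℝ) • (A n *ᵥ WithLp.ofLp (βhat n ω - βs n))) :
        EuclideanSpace ℝ (Fin q)))
      atTop id P (multivariateGaussian 0 (σ ^ 2 • GX)) := by
  have hd1 : ∀ᶠ n in atTop, 1 ≤ d n := hd.eventually_ge_atTop 1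
  have hd5 := tendsto_pow_five_div_of_isLittleO hd hdn
  have hd3 : Tendsto (fun n : ℕ => (d n : ℝ) ^ 3 / n) atTop (𝓝 0) := by
    refine squeeze_zero' (Eventually.of_forall fun n => by positivity) ?_ hd5
    filter_upwards [hd1] with n hn
    have : (1 : ℝ) ≤ d n := by exact_mod_cast hn
    gcongr
    norm_num
  have hdinv : Tendsto (fun n => ((d n : ℝ))⁻¹) atTop (𝓝 0) :=
    tendsto_inv_atTop_zero.comp (tendsto_natCast_atTop_atTop.comp hd)
  have hQ2 : ∫ e, e ^ 2 ∂Q = σ ^ 2 := by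
    rw [← hεvar, variance_of_integral_eq_zero aemeasurable_id (by simpa using hεmean)]
    rfl
  obtain ⟨c, hc0, hc⟩ := hB1'
  obtain ⟨K, hK⟩ := hC
  obtain ⟨F, hF⟩ := hDA
  have hk0 : ∀ n, 0 ≤ kappaX (ν n) := fun n => by unfold kappaX; positivity
  -- the exceptional events
  let gram : (n : ℕ) → Ω n → ℝ := fun n ω => √(∑ p : Fin (d n) × Fin (d n),
    ((n : ℝ)⁻¹ * ∑ i, X n i ω p.1 * X n i ω p.2 - covarianceMat (ν n) p.1 p.2) ^ 2)
  -- The score typically has size `√(n d)`. The extra factor `√d` in the threshold makes the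
  -- Chebyshev bound of order `1 / d`; the Gram threshold `√(d³ / n)` below has the same slack.
  have hscore : Tendsto (fun n => P n {ω | √n * d n < ‖∑ i, ε n i ω • X n i ω‖}) atTop (𝓝 0) := by
    have hlim : Tendsto (fun n => ENNReal.ofReal (K * σ ^ 2 * (d n : ℝ)⁻¹)) atTop (𝓝 0) := by
      simpa using ENNReal.tendsto_ofReal (hdinv.const_mul (K * σ ^ 2))
    refine tendsto_of_tendsto_of_tendsto_of_le_of_le' tendsto_const_nhds hlim
      (Eventually.of_forall fun _ => zero_le) ?_
    filter_upwards [hK, hd1, eventually_gt_atTop 0] with n h1 h2 h3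
    have h2' : (0 : ℝ) < d n := by exact_mod_cast h2
    refine (measure_lt_norm_score_le h3 h2 (hXlaw n) (hXindep n) (hXmom n) (hεlaw n) (hεindep n)
      hεmom hεmean (hXε n) h2').trans (ENNReal.ofReal_le_ofReal ?_)
    rw [hQ2]
    calc (d n : ℝ) * kappaX (ν n) * σ ^ 2 / (d n : ℝ) ^ 2 ≤ d n * K * σ ^ 2 / (d n : ℝ) ^ 2 := by
          gcongr
      _ = _ := by field_simp
  have hgram : Tendsto (fun n => P n {ω | √((d n : ℝ) ^ 3 / n) < gram n ω}) atTop (𝓝 0) := by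
    have hlim : Tendsto (fun n => ENNReal.ofReal (K ^ 2 * (d n : ℝ)⁻¹)) atTop (𝓝 0) := by
      simpa using ENNReal.tendsto_ofReal (hdinv.const_mul (K ^ 2))
    refine tendsto_of_tendsto_of_tendsto_of_le_of_le' tendsto_const_nhds hlim
      (Eventually.of_forall fun _ => zero_le) ?_
    filter_upwards [hK, hd1, eventually_gt_atTop 0] with n h1 h2 h3
    have h2' : (0 : ℝ) < d n := by exact_mod_cast h2
    have h3' : (0 : ℝ) < n := by exact_mod_cast h3
    refine (measure_lt_gram_error_le h3 h2 (hXlaw n) (hXindep n) (hXmom n) (hXmean n)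
      (by positivity)).trans (ENNReal.ofReal_le_ofReal ?_)
    rw [Real.sq_sqrt (by positivity)]
    have h4 := hk0 n
    calc (d n * kappaX (ν n)) ^ 2 / (n * ((d n : ℝ) ^ 3 / n))
        ≤ (d n * K) ^ 2 / (n * ((d n : ℝ) ^ 3 / n)) := by gcongr
      _ = _ := by field_simp
  have hbad := tendsto_measure_union_five hXmax hεmax hβhat hscore hgram
  have hγlam : ∀ n, γ n ≤ lam n := fun n => by
    have := hlamγ n; have := hγpos n; nlinarith
  obtain ⟨η, hη, hη0, hDc, hsmall, hηle⟩ := exists_linearization_rate hc0 hκpos hγpos hlampos hα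
    hlamκ hlamγ hd1 hd3 hd5 hs₁ hs₂
  have hlin : ∀ᶠ n in atTop, ∀ (b : EuclideanSpace ℝ (Fin (d n))) ω,
      ω ∉ {ω | ∃ i, κ n < ‖X n i ω‖} ∪ {ω | ∃ i, γ n < |ε n i ω|} ∪
        {ω | ¬ IsPLSEstimate (fun i => X n i ω) (fun i => Y n i ω) (lam n) (βhat n ω)} ∪
        {ω | √n * d n < ‖∑ i, ε n i ω • X n i ω‖} ∪ {ω | √((d n : ℝ) ^ 3 / n) < gram n ω} →
      |√n * covForm (ν n) b (βhat n ω - βs n) -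
        (√n)⁻¹ * ∑ i, ε n i ω * inner ℝ (X n i ω) b| ≤ ‖b‖ * η n := by
    filter_upwards [hc, hDc, hsmall, hηle, hlamμ 3, eventually_gt_atTop 0] with n h1 h2 h3 h4 h5 h6
    intro b ω hω
    simp only [Set.mem_union, Set.mem_ofPred_eq, not_or, not_exists, not_lt, not_not] at hω
    obtain ⟨⟨⟨⟨hω1, hω2⟩, hω3⟩, hω4⟩, hω5⟩ := hω
    refine (hω3.abs_linearization_le h6 (covForm (ν n)) hc0 (hκpos n).le (hγpos n).le
      (Real.sqrt_nonneg ((d n : ℝ) ^ 3 / n)) (hlampos n) (hγlam n) (fun i => hY n i ω)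
      (mul_norm_sq_le_covForm h1) (fun w w' => ?_) hω1 hω2 hω4 h5 (hμbdd n) (hμzero n) h2 h3
      b).trans (mul_le_mul_of_nonneg_left h4 (norm_nonneg _))
    refine (abs_gram_sub_covForm_le _ w w').trans ?_
    gcongr
  -- reduction to characteristic functions
  let T : (n : ℕ) → Ω n → EuclideanSpace ℝ (Fin q) := fun n ω =>
    WithLp.toLp 2 (√(n : ℝ) • (A n *ᵥ WithLp.ofLp (βhat n ω - βs n)))
  have hmeas : ∀ n, AEMeasurable (T n) (P n) := by
    intro n
    have h : Continuous fun v : EuclideanSpace ℝ (Fin (d n)) =>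
        (WithLp.toLp 2 (√(n : ℝ) • (A n *ᵥ WithLp.ofLp (v - βs n))) :
          EuclideanSpace ℝ (Fin q)) := by fun_prop
    exact h.measurable.comp_aemeasurable (hβmeas n)
  refine ⟨hmeas, aemeasurable_id, ProbabilityMeasure.tendsto_iff_tendsto_charFun.2 fun t => ?_⟩
  let b : (n : ℕ) → Fin (d n) → ℝ := fun n => (A n)ᵀ *ᵥ WithLp.ofLp t
  -- With this direction the covariance form of `a n` and the estimation error is exactly the
  -- component of `A n` times that error along `t`.
  let a : (n : ℕ) → EuclideanSpace ℝ (Fin (d n)) := fun n => covDual (ν n) (b n)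
  have hanorm : ∀ᶠ n in atTop, ‖a n‖ ≤ F * ‖t‖ / c := by
    filter_upwards [hc, hF] with n h1 h2
    refine (norm_covDual_le hc0 h1 (b n)).trans ?_
    gcongr
    exact (norm_mulVec_transpose_le (A n) t).trans (by gcongr)
  have haa : ∀ (t : Fin q → ℝ), Tendsto (fun n => covForm (ν n) (covDual (ν n) ((A n)ᵀ *ᵥ t))
      (covDual (ν n) ((A n)ᵀ *ᵥ t))) atTop (𝓝 (t ⬝ᵥ (GX *ᵥ t))) := by
    intro t
    refine (tendsto_dotProduct_mulVec_of_frobNorm hDlim t).congr' ?_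
    filter_upwards [hc] with n h1
    rw [covForm_covDual hc0 h1, covDual, mulVec_transpose, ← dotProduct_mulVec,
      mulVec_mulVec, ← mulVec_transpose, mulVec_mulVec]
  -- `GX` is only assumed symmetric; its quadratic form is nonnegative as a limit of variances.
  have hGX : (σ ^ 2 • GX).PosSemidef := by
    refine PosSemidef.smul (PosSemidef.of_dotProduct_mulVec_nonneg ?_ fun x => ?_) (sq_nonneg σ)
    · simpa [IsHermitian, IsSymm] using hDsymm
    · refine ge_of_tendsto (haa x) ?_
      filter_upwards [hc] with n h1
      exact le_trans (by positivity) (mul_norm_sq_le_covForm h1 _)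
  have hclt := tendsto_charFun_score P d ν Q X ε hXlaw hXindep hXmom hXmean hεlaw hεindep hεmom
    hεmean hXε ⟨K, hK⟩ hd hd3 a ⟨_, hanorm⟩ (haa (WithLp.ofLp t))
  have hW : ∀ᶠ n in atTop, ∀ ω, inner ℝ (T n ω) t =
      √n * covForm (ν n) (a n) (βhat n ω - βs n) := by
    filter_upwards [hc] with n h1 ω
    rw [covForm_covDual hc0 h1, EuclideanSpace.inner_eq_star_dotProduct, star_trivial]
    simp only [T, b]
    rw [dotProduct_smul, mulVec_transpose, ← dotProduct_mulVec, smul_eq_mul]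
  have hdiff : Tendsto (fun n => (∫ ω, Complex.exp (((inner ℝ (T n ω) t : ℝ) : ℂ) *
        Complex.I) ∂(P n)) - ∫ ω, Complex.exp
      (((√(n : ℝ))⁻¹ * ∑ i, ε n i ω * inner ℝ (X n i ω) (a n) : ℝ) * Complex.I) ∂(P n)) atTop
      (𝓝 0) := by
    have hlim : Tendsto (fun n => F * ‖t‖ / c * η n + 2 * (P n).real
        ({ω | ∃ i, κ n < ‖X n i ω‖} ∪ {ω | ∃ i, γ n < |ε n i ω|} ∪
        {ω | ¬ IsPLSEstimate (fun i => X n i ω) (fun i => Y n i ω) (lam n) (βhat n ω)} ∪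
        {ω | √n * d n < ‖∑ i, ε n i ω • X n i ω‖} ∪ {ω | √((d n : ℝ) ^ 3 / n) < gram n ω}))
        atTop (𝓝 0) := by
      simpa using (hη.const_mul (F * ‖t‖ / c)).add (hbad.const_mul 2)
    refine squeeze_zero_norm' ?_ hlim
    filter_upwards [hlin, hW, hanorm] with n h1 h2 h3
    have h4 : 0 ≤ F * ‖t‖ / c := (norm_nonneg _).trans h3
    refine norm_integral_cexp_sub_le (by have := hmeas n; fun_prop) ?_ (mul_nonneg h4 (hη0 n))
      fun ω hω => ?_
    · have h5 := fun i => (hXlaw n i).aemeasurable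
      have h6 := fun i => (hεlaw n i).aemeasurable
      refine (Finset.aemeasurable_fun_sum _ fun i _ => ?_).const_mul _
      have := h5 i
      have := h6 i
      fun_prop
    · rw [h2]
      exact (h1 (a n) ω hω).trans (mul_le_mul_of_nonneg_right h3 (hη0 n))
  have hsum := hdiff.add hclt
  simp only [sub_add_cancel, zero_add] at hsum
  refine (tendsto_congr fun n => ?_).2 (hsum.trans_eq ?_)
  · simp only [ProbabilityMeasure.coe_mk]
    rw [charFun_apply, integral_map (hmeas n) (by fun_prop)]
  · simp only [ProbabilityMeasure.coe_mk, Measure.map_id]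
    rw [charFun_multivariateGaussian hGX, inner_zero_right, hQ2]
    congr 2
    simp [smul_mulVec, dotProduct_smul]
    ring
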